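/- **Theorem (energy stability).** Let $d\in\{2,3\}$, let $\Omega\subset\mathbb R^d$ be a bounded convex polygonal ($d=2$) or polyhedral ($d=3$) domain, and let $\nu,\sigma,\mu>0$. In dimension two, for vectors $a,b$ and a scalar $c$, put $a\times b=a_1b_2-a_2b_1$, $a\times c=(a_2c,-a_1c)$; $\nabla\times w=\partial_1w_2-\partial_2w_1$ is a scalar, $J$ is a scalar and $\nabla\times J=(\partial_2J,-\partial_1J)$. Write $(\cdot,\cdot)$ and $\|\cdot\|$ for the inner product and norm of $L^2(\Omega)$, and $b(u,v,w)=(u\cdot\nabla v,w)+\tfrac12((\nabla\cdot u)v,w)$. For a conforming triangulation of $\Omega$ (mesh size $h$) and an integer $r\ge2$, let $X_h$ be the space of all $v\in H^1_0(\Omega)^d$, $S_h$ the space of all $w\in H^1(\Omega)^d$ with $w\times n=0$ on $\partial\Omega$, both with components that are polynomials of degree at most $r$ on every element, and let $M_h$ be the space of all $q\in L^2(\Omega)$ with $\int_\Omega q\,dx=0$ that are polynomials of degree at most $r-1$ on every element. The discrete gradient $\nabla_h:M_h\to X_h$ is defined by $(v_h,\nabla_hq_h)=-(\nabla\cdot v_h,q_h)$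 for all $v_h\in X_h$. Let $T>0$, $N\ge1$, $\tau=T/N$. For $1\le n\le N-1$ let $J^{n+\frac12}=J(\cdot,(n+\tfrac12)\tau)\in L^2$ have a weak curl in $L^2$ and let $f^{n+\frac12}=f(\cdot,(n+\tfrac12)\tau)\in L^2$. Let $H_h^n\in S_h$, $u_h^n\in X_h$ $(0\le n\le N)$, $\widehat u_h^n\in X_h$ $(2\le n\le N)$, $p_h^n\in M_h$ $(1\le n\le N)$ satisfy, for $n=1,\dots,N-1$ and all $w_h\in S_h$, $v_h,l_h\in X_h$, $q_h\in M_h$, $$\mu\Big(\tfrac{H_h^{n+1}-H_h^n}{\tau},w_h\Big)+\sigma^{-1}(\nabla\times\check H_h,\nabla\times w_h)+\sigma^{-1}(\nabla\cdot\check H_h,\nabla\cdot w_h)-\mu(\bar u_h\times\tilde H_h,\nabla\times w_h)=\sigma^{-1}(\nabla\times J^{n+\frac12},w_h),$$ $$\Big(\tfrac{\widehat u_h^{n+1}-u_h^n}{\tau},v_h\Big)+\nu(\nabla\bar u_h,\nabla v_h)+b(\tilde u_h,\bar u_h,v_h)-(p_h^n,\nabla\cdot v_h)+\mu(\tilde H_h\times(\nabla\times\check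 H_h),v_h)=(f^{n+\frac12},v_h),$$ $$\Big(\tfrac{u_h^{n+1}-\widehat u_h^{n+1}}{\tau},l_h\Big)-\tfrac12(p_h^{n+1}-p_h^n,\nabla\cdot l_h)=0,\qquad(\nabla\cdot u_h^{n+1},q_h)=0,$$ where $\check H_h=\tfrac34H_h^{n+1}+\tfrac14H_h^{n-1}$, $\bar u_h=\tfrac12\widehat u_h^{n+1}+\tfrac12u_h^n$, $\tilde H_h=\tfrac32H_h^n-\tfrac12H_h^{n-1}$, $\tilde u_h=\tfrac32u_h^n-\tfrac12u_h^{n-1}$. Then, for $n=1,\dots,N-1$, where for $n=1$ it is also assumed that the starting velocity is discretely divergence-free, $(\nabla\cdot u_h^1,q_h)=0$ for all $q_h\in M_h$, $$\frac{\mu}{2\tau}\big(\|H_h^{n+1}\|^2-\|H_h^n\|^2\big)+\frac{\mu}{8\tau}\big(\|H_h^{n+1}-H_h^n\|^2-\|H_h^n-H_h^{n-1}\|^2\big)+\frac1{2\tau}\big(\|u_h^{n+1}\|^2-\|u_h^n\|^2\big)+\frac\tau8\big(\|\nabla_hp_h^{n+1}\|^2-\|\nabla_hp_h^n\|^2\big)\le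 C\big(\|J^{n+\frac12}\|^2+\|f^{n+\frac12}\|^2\big)$$ with a constant $C>0$ that depends only on $\Omega,\nu,\sigma,\mu$; in particular $C$ does not depend on $\tau$, $h$, the triangulation, $r$, $T$, $N$, $n$, the sources or the numerical solution, and there is no restriction on $\tau$ or $h$. -/

import Mathlib

open MeasureTheory Filter Topology
open scoped ContDiff Matrix

noncomputable section

namespace MHD

/-- The ambient Euclidean space `ℝ^d`. -/
abbrev E (d : ℕ) := EuclideanSpace ℝ (Fin d)

/-! ### Domains and triangulations -/

/-- A bounded convex polyhedral (polygonal if `d = 2`) domain: the nonempty interior of the convex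
hull of finitely many points. -/
def IsConvexPolyhedralDomain {d : ℕ} (Ω : Set (E d)) : Prop :=
  Ω.Nonempty ∧ ∃ V : Finset (E d), Ω = interior (convexHull ℝ (V : Set (E d)))

/-- A (conforming) triangulation of `Ω`: a finite simplicial complex whose underlying space is the
closure of `Ω`. -/
structure IsTriangulation {d : ℕ} (Ω : Set (E d)) (K : Geometry.SimplicialComplex ℝ (E d)) :
    Prop where
  finite : K.faces.Finite
  space_eq : K.space = closure Ω

/-- The elements of a triangulation, given by their vertex sets: the faces with `d + 1` vertices
(triangles if `d = 2`, tetrahedra if `d = 3`). -/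
def elements {d : ℕ} (K : Geometry.SimplicialComplex ℝ (E d)) : Set (Finset (E d)) :=
  {s | s ∈ K.faces ∧ s.card = d + 1}

/-! ### Vector calculus in dimensions two and three

In dimension two the curl of a vector field, the cross product of two vectors and the source `J`
are scalars, which are stored as vectors with one component. In other dimensions these operations
are not used. A gradient matrix `G` has the entries `G i j = ∂_j v_i`. -/

/-- Number of components of a curl. -/
abbrev curlDim : ℕ → ℕ
  | 3 => 3
  | _ => 1

/-- The curl as a function of the gradient matrix: `∂₁ v₂ - ∂₂ v₁` if `d = 2`, and
`(∂₂ v₃ - ∂₃ v₂, ∂₃ v₁ - ∂₁ v₃, ∂₁ v₂ - ∂₂ v₁)` if `d = 3`. -/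
def curlOf : (d : ℕ) → Matrix (Fin d) (Fin d) ℝ → (Fin (curlDim d) → ℝ)
  | 2, G => ![G 1 0 - G 0 1]
  | 3, G => ![G 2 1 - G 1 2, G 0 2 - G 2 0, G 1 0 - G 0 1]
  | _, _ => 0

/-- The cross product `a × b` of two vectors; it is the scalar `a₁ b₂ - a₂ b₁` if `d = 2`. -/
def cross : (d : ℕ) → (Fin d → ℝ) → (Fin d → ℝ) → (Fin (curlDim d) → ℝ)
  | 2, a, b => ![a 0 * b 1 - a 1 * b 0]
  | 3, a, b => a ⨯₃ b
  | _, _, _ => 0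

/-- The cross product `a × c` of a vector and a curl; it is `(a₂ c, - a₁ c)` if `d = 2`. -/
def crossCurl : (d : ℕ) → (Fin d → ℝ) → (Fin (curlDim d) → ℝ) → (Fin d → ℝ)
  | 2, a, c => ![a 1 * c (0 : Fin 1), - (a 0 * c (0 : Fin 1))]
  | 3, a, c => a ⨯₃ c
  | _, _, _ => 0

/-! ### The `L²` inner product -/

/-- The `L²(Ω)` inner product of two vector fields. -/
def l2inner {d m : ℕ} (Ω : Set (E d)) (a b : E d → Fin m → ℝ) : ℝ :=
  ∫ x in Ω, a x ⬝ᵥ b x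

/-- The square of the `L²(Ω)` norm of a vector field. -/
def normSq {d m : ℕ} (Ω : Set (E d)) (a : E d → Fin m → ℝ) : ℝ := l2inner Ω a a

/-! ### Weak derivatives and Sobolev spaces -/

/-- Smooth functions or fields with compact support in `Ω`. -/
structure IsTestField {d : ℕ} {F : Type*} [NormedAddCommGroup F] [NormedSpace ℝ F]
    (Ω : Set (E d)) (φ : E d → F) : Prop where
  contDiff : ContDiff ℝ ∞ φ
  compact : HasCompactSupport φ
  support : tsupport φ ⊆ Ω

/-- The classical partial derivative `∂_j φ`. -/
def partialDeriv {d : ℕ} (j : Fin d) (φ : E d → ℝ) (x : E d) : ℝ :=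
  fderiv ℝ φ x (EuclideanSpace.single j 1)

/-- The classical curl of a smooth field. -/
def classicalCurl {d : ℕ} (φ : E d → Fin d → ℝ) (x : E d) : Fin (curlDim d) → ℝ :=
  curlOf d (fun i j => partialDeriv j (fun y => φ y i) x)

/-- `g ∈ L²(Ω)` is the weak partial derivative `∂_j v` in `Ω`. -/
structure IsWeakPartial {d : ℕ} (Ω : Set (E d)) (j : Fin d) (v g : E d → ℝ) : Prop where
  memLp : MemLp g 2 (volume.restrict Ω)
  integral_eq : ∀ φ : E d → ℝ, IsTestField Ω φ →
    ∫ x in Ω, v x * partialDeriv j φ x = - ∫ x in Ω, g x * φ x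

open Classical in
/-- The weak partial derivative (unique almost everywhere in `Ω`) of a function in `H¹(Ω)`. -/
def weakPartial {d : ℕ} (Ω : Set (E d)) (j : Fin d) (v : E d → ℝ) : E d → ℝ :=
  if h : ∃ g, IsWeakPartial Ω j v g then h.choose else 0

/-- The Sobolev space `H¹(Ω)`. -/
structure MemH1 {d : ℕ} (Ω : Set (E d)) (v : E d → ℝ) : Prop where
  memLp : MemLp v 2 (volume.restrict Ω)
  exists_partial : ∀ j, ∃ g, IsWeakPartial Ω j v g

/-- The Sobolev space `H¹₀(Ω)`: the closure of the test functions in `H¹(Ω)`. -/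
structure MemH10 {d : ℕ} (Ω : Set (E d)) (v : E d → ℝ) : Prop where
  memH1 : MemH1 Ω v
  approx : ∃ φ : ℕ → E d → ℝ, (∀ k, IsTestField Ω (φ k)) ∧
    Tendsto (fun k => eLpNorm (fun x => φ k x - v x) 2 (volume.restrict Ω)) atTop (𝓝 0) ∧
    ∀ j, Tendsto (fun k => eLpNorm (fun x => partialDeriv j (φ k) x - weakPartial Ω j v x) 2
      (volume.restrict Ω)) atTop (𝓝 0)

/-- The weak gradient matrix of a vector field. -/
def weakGrad {d : ℕ} (Ω : Set (E d)) (v : E d → Fin d → ℝ) (x : E d) : Matrix (Fin d) (Fin d) ℝ :=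
  fun i j => weakPartial Ω j (fun y => v y i) x

/-- The weak divergence of a vector field. -/
def div {d : ℕ} (Ω : Set (E d)) (v : E d → Fin d → ℝ) (x : E d) : ℝ := (weakGrad Ω v x).trace

/-- The weak curl of a vector field in `H¹(Ω)^d`. -/
def curl {d : ℕ} (Ω : Set (E d)) (v : E d → Fin d → ℝ) (x : E d) : Fin (curlDim d) → ℝ :=
  curlOf d (weakGrad Ω v x)

/-- The space of the `w ∈ H¹(Ω)^d` with vanishing tangential trace, `w × n = 0` on `∂Ω`, that is,
`H¹(Ω)^d ∩ H₀(curl; Ω)`, where `H₀(curl; Ω)` is the closure of the test fields for the norm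
`(‖w‖² + ‖∇ × w‖²)^(1/2)`. -/
structure MemRingH1 {d : ℕ} (Ω : Set (E d)) (w : E d → Fin d → ℝ) : Prop where
  memH1 : ∀ i, MemH1 Ω (fun x => w x i)
  approx : ∃ φ : ℕ → E d → Fin d → ℝ, (∀ k, IsTestField Ω (φ k)) ∧
    Tendsto (fun k => eLpNorm (fun x => φ k x - w x) 2 (volume.restrict Ω)) atTop (𝓝 0) ∧
    Tendsto (fun k => eLpNorm (fun x => classicalCurl (φ k) x - curl Ω w x) 2
      (volume.restrict Ω)) atTop (𝓝 0)

/-- `g ∈ L²(Ω)^d` is the weak curl of the source `J`. If `d = 2`, then `J` is a scalar and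
`∇ × J = (∂₂ J, - ∂₁ J)`. -/
structure IsSourceCurl {d : ℕ} (Ω : Set (E d)) (J : E d → Fin (curlDim d) → ℝ)
    (g : E d → Fin d → ℝ) : Prop where
  memLp : MemLp g 2 (volume.restrict Ω)
  integral_eq : ∀ φ : E d → Fin d → ℝ, IsTestField Ω φ →
    l2inner Ω J (classicalCurl φ) = l2inner Ω g φ

/-- Sources in `L²(Ω)` with weak curl in `L²(Ω)`. -/
structure MemHCurl {d : ℕ} (Ω : Set (E d)) (J : E d → Fin (curlDim d) → ℝ) : Prop where
  memLp : MemLp J 2 (volume.restrict Ω)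
  exists_curl : ∃ g, IsSourceCurl Ω J g

open Classical in
/-- The weak curl `∇ × J` (unique almost everywhere in `Ω`) of a source. -/
def sourceCurl {d : ℕ} (Ω : Set (E d)) (J : E d → Fin (curlDim d) → ℝ) : E d → Fin d → ℝ :=
  if h : ∃ g, IsSourceCurl Ω J g then h.choose else 0

/-! ### Finite element spaces -/

/-- `v` is, on each element, (almost everywhere) a polynomial of degree at most `r`. -/
def IsPiecewisePoly {d : ℕ} (K : Geometry.SimplicialComplex ℝ (E d)) (r : ℕ) (v : E d → ℝ) :
    Prop :=
  ∀ s ∈ elements K, ∃ P : MvPolynomial (Fin d) ℝ, P.totalDegree ≤ r ∧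
    ∀ᵐ x ∂(volume.restrict (convexHull ℝ (s : Set (E d)))), v x = MvPolynomial.eval (fun i => x i) P

/-- The velocity space `X_h`. -/
structure MemX {d : ℕ} (Ω : Set (E d)) (K : Geometry.SimplicialComplex ℝ (E d)) (r : ℕ)
    (v : E d → Fin d → ℝ) : Prop where
  memH10 : ∀ i, MemH10 Ω (fun x => v x i)
  poly : ∀ i, IsPiecewisePoly K r (fun x => v x i)

/-- The pressure space `M_h`. -/
structure MemM {d : ℕ} (Ω : Set (E d)) (K : Geometry.SimplicialComplex ℝ (E d)) (r : ℕ)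
    (q : E d → ℝ) : Prop where
  memLp : MemLp q 2 (volume.restrict Ω)
  poly : IsPiecewisePoly K (r - 1) q
  mean_zero : ∫ x in Ω, q x = 0

/-- The magnetic space `S_h`. -/
structure MemS {d : ℕ} (Ω : Set (E d)) (K : Geometry.SimplicialComplex ℝ (E d)) (r : ℕ)
    (w : E d → Fin d → ℝ) : Prop where
  memRingH1 : MemRingH1 Ω w
  poly : ∀ i, IsPiecewisePoly K r (fun x => w x i)

/-- `g ∈ X_h` is the discrete gradient of `q`: `(v, g) = - (∇ · v, q)` for all `v ∈ X_h`. -/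
structure IsDiscreteGrad {d : ℕ} (Ω : Set (E d)) (K : Geometry.SimplicialComplex ℝ (E d)) (r : ℕ)
    (q : E d → ℝ) (g : E d → Fin d → ℝ) : Prop where
  memX : MemX Ω K r g
  inner_eq : ∀ v, MemX Ω K r v → l2inner Ω v g = - ∫ x in Ω, div Ω v x * q x

open Classical in
/-- The discrete gradient operator `∇_h : M_h → X_h` (its value is unique almost everywhere in
`Ω`). -/
def discreteGrad {d : ℕ} (Ω : Set (E d)) (K : Geometry.SimplicialComplex ℝ (E d)) (r : ℕ)
    (q : E d → ℝ) : E d → Fin d → ℝ :=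
  if h : ∃ g, IsDiscreteGrad Ω K r q g then h.choose else 0

/-- `(∇ · u, q) = 0` for all `q ∈ M_h`. -/
def IsDiscretelyDivFree {d : ℕ} (Ω : Set (E d)) (K : Geometry.SimplicialComplex ℝ (E d)) (r : ℕ)
    (u : E d → Fin d → ℝ) : Prop :=
  ∀ q, MemM Ω K r q → ∫ x in Ω, div Ω u x * q x = 0

/-! ### The fully discrete scheme -/

/-- `(∇u, ∇v)`. -/
def gradInner {d : ℕ} (Ω : Set (E d)) (u v : E d → Fin d → ℝ) : ℝ :=
  ∫ x in Ω, ∑ i, ∑ j, weakGrad Ω u x i j * weakGrad Ω v x i j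

/-- The trilinear form `b(u, v, w) = (u · ∇v, w) + (1/2) ((∇ · u) v, w)`. -/
def trilinear {d : ℕ} (Ω : Set (E d)) (u v w : E d → Fin d → ℝ) : ℝ :=
  l2inner Ω (fun x => weakGrad Ω v x *ᵥ u x) w + 1 / 2 * l2inner Ω (fun x => div Ω u x • v x) w

/-- The average `(3/4) v^{n+1} + (1/4) v^{n-1}`. -/
def check {d : ℕ} (v : ℕ → E d → Fin d → ℝ) (n : ℕ) : E d → Fin d → ℝ :=
  (3 / 4 : ℝ) • v (n + 1) + (1 / 4 : ℝ) • v (n - 1)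

/-- The average `(1/2) v̂^{n+1} + (1/2) v^n`. -/
def average {d : ℕ} (vhat v : ℕ → E d → Fin d → ℝ) (n : ℕ) : E d → Fin d → ℝ :=
  (1 / 2 : ℝ) • vhat (n + 1) + (1 / 2 : ℝ) • v n

/-- The extrapolation `(3/2) v^n - (1/2) v^{n-1}`. -/
def extrapolate {d : ℕ} (v : ℕ → E d → Fin d → ℝ) (n : ℕ) : E d → Fin d → ℝ :=
  (3 / 2 : ℝ) • v n - (1 / 2 : ℝ) • v (n - 1)

/-- The midpoint `t_{n+1/2} = (n + 1/2) τ`. -/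
def midTime (τ : ℝ) (n : ℕ) : ℝ := ((n : ℝ) + 1 / 2) * τ

/-- `(H, u, û, p)` is a numerical solution on the time levels `0, …, N` with step size `τ` and
sources `J`, `f`. The values on the levels `0` and `1` are given starting values in the finite
element spaces, and the steps from level `n` to level `n + 1`, for `1 ≤ n ≤ N - 1`, are those of the
linearized Crank-Nicolson projection scheme. -/
structure IsNumericalSolution {d : ℕ} (Ω : Set (E d)) (K : Geometry.SimplicialComplex ℝ (E d))
    (r : ℕ) (ν σ μ τ : ℝ) (N : ℕ)
    (J : ℝ → E d → Fin (curlDim d) → ℝ) (f : ℝ → E d → Fin d → ℝ)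
    (H u uhat : ℕ → E d → Fin d → ℝ) (p : ℕ → E d → ℝ) : Prop where
  H_mem : ∀ n, n ≤ N → MemS Ω K r (H n)
  u_mem : ∀ n, n ≤ N → MemX Ω K r (u n)
  uhat_mem : ∀ n, 2 ≤ n → n ≤ N → MemX Ω K r (uhat n)
  p_mem : ∀ n, 1 ≤ n → n ≤ N → MemM Ω K r (p n)
  magnetic : ∀ n, 1 ≤ n → n < N → ∀ w, MemS Ω K r w →
    μ * l2inner Ω (τ⁻¹ • (H (n + 1) - H n)) w
      + σ⁻¹ * l2inner Ω (curl Ω (check H n)) (curl Ω w)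
      + σ⁻¹ * (∫ x in Ω, div Ω (check H n) x * div Ω w x)
      - μ * l2inner Ω (fun x => cross d (average uhat u n x) (extrapolate H n x)) (curl Ω w)
      = σ⁻¹ * l2inner Ω (sourceCurl Ω (J (midTime τ n))) w
  momentum : ∀ n, 1 ≤ n → n < N → ∀ v, MemX Ω K r v →
    l2inner Ω (τ⁻¹ • (uhat (n + 1) - u n)) v
      + ν * gradInner Ω (average uhat u n) v
      + trilinear Ω (extrapolate u n) (average uhat u n) v
      - (∫ x in Ω, p n x * div Ω v x)
      + μ * l2inner Ω (fun x => crossCurl d (extrapolate H n x) (curl Ω (check H n) x)) v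
      = l2inner Ω (f (midTime τ n)) v
  projection : ∀ n, 1 ≤ n → n < N → ∀ l, MemX Ω K r l →
    l2inner Ω (τ⁻¹ • (u (n + 1) - uhat (n + 1))) l
      - 1 / 2 * (∫ x in Ω, (p (n + 1) x - p n x) * div Ω l x) = 0
  incompressible : ∀ n, 1 ≤ n → n < N → IsDiscretelyDivFree Ω K r (u (n + 1))

end MHD

end

/-! Each step satisfies an energy balance. Test the magnetic equation with `check H n` and the
momentum equation with `average uhat u n`, and add. The two Lorentz terms cancel by the triple
product identity `crossCurl_dotProduct`, and convection drops out by skew-symmetry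
(`trilinear_self`). What remains is the discrete time derivatives, the dissipation, the pressure
term and the sources.

The magnetic time difference dominates a telescoping energy (`le_l2inner_check`). The pressure term
has no sign of its own. Since u^{n+1} is orthogonal to both discrete gradients, the projection step
turns it, together with the velocity difference, into an exact difference of ‖u‖²/(2τ) + τ‖∇_h p‖²/8
(`velocity_pressure_identity`).

Integration by parts moves the curl from J to `check H n`, and Young's inequality absorbs the result
into the curl dissipation. The term with f is absorbed into the viscosity by the Poincaré inequality
on Ω ⊆ {‖x‖ ≤ R}. No inverse or Gronwall inequality enters, so C = 1/(2σ) + R²/ν works with no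
condition on τ or h.

The remaining work is analytic: weak derivatives are chosen representatives, linear only almost
everywhere; piecewise polynomials are bounded, which makes the convection integrals meaningful; the
discrete gradient exists by a finite-dimensional Riesz argument. -/

noncomputable section

namespace MHD

/-! ### Convergence in `L²` -/

section LTwo

variable {α : Type*} [MeasurableSpace α] {ρ : Measure α}

lemma integrable_mul_of_memLp_two {f g : α → ℝ} (hf : MemLp f 2 ρ) (hg : MemLp g 2 ρ) :
    Integrable (fun x => f x * g x) ρ :=
  MemLp.integrable_mul hf hg

/-- Hölder's inequality turns L² convergence of `f k` into L¹ convergence of `h * f k`. -/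
lemma tendsto_integral_mul_of_eLpNorm {f : ℕ → α → ℝ} {g h : α → ℝ} (hf : ∀ k, MemLp (f k) 2 ρ)
    (hg : MemLp g 2 ρ) (hh : MemLp h 2 ρ)
    (hlim : Tendsto (fun k => eLpNorm (fun x => f k x - g x) 2 ρ) atTop (𝓝 0)) :
    Tendsto (fun k => ∫ x, h x * f k x ∂ρ) atTop (𝓝 (∫ x, h x * g x ∂ρ)) := by
  refine tendsto_integral_of_L1' _ (integrable_mul_of_memLp_two hh hg).aestronglyMeasurable
    (Eventually.of_forall fun k => integrable_mul_of_memLp_two hh (hf k)) ?_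
  have hub : Tendsto (fun k => eLpNorm h 2 ρ * eLpNorm (fun x => f k x - g x) 2 ρ)
      atTop (𝓝 0) := by
    simpa using ENNReal.Tendsto.const_mul hlim (Or.inr hh.eLpNorm_ne_top)
  refine tendsto_of_tendsto_of_tendsto_of_le_of_le tendsto_const_nhds hub (fun _ => zero_le)
    fun k => ?_
  have hfg : AEStronglyMeasurable (fun x => f k x - g x) ρ :=
    ((hf k).sub hg).aestronglyMeasurable
  have he : ((fun x => h x * f k x) - fun x => h x * g x) = h • fun x => f k x - g x := by
    ext x
    simp only [Pi.sub_apply, Pi.smul_apply', smul_eq_mul, mul_sub]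
  show eLpNorm ((fun x => h x * f k x) - fun x => h x * g x) 1 ρ ≤
    eLpNorm h 2 ρ * eLpNorm (fun x => f k x - g x) 2 ρ
  rw [he]
  exact eLpNorm_smul_le_mul_eLpNorm hfg hh.aestronglyMeasurable

/-- The limit `h₀` need only be the combination almost everywhere, because `weakPartial` and `curl`
are linear only in that sense. -/
lemma tendsto_eLpNorm_lincomb {F : Type*} [NormedAddCommGroup F] [NormedSpace ℝ F]
    {f g : ℕ → α → F} {f₀ g₀ h₀ : α → F} {h : ℕ → α → F}
    (a b : ℝ) (hf : ∀ k, AEStronglyMeasurable (f k) ρ) (hf₀ : AEStronglyMeasurable f₀ ρ)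
    (hg : ∀ k, AEStronglyMeasurable (g k) ρ) (hg₀ : AEStronglyMeasurable g₀ ρ)
    (hfl : Tendsto (fun k => eLpNorm (fun x => f k x - f₀ x) 2 ρ) atTop (𝓝 0))
    (hgl : Tendsto (fun k => eLpNorm (fun x => g k x - g₀ x) 2 ρ) atTop (𝓝 0))
    (hh : ∀ k x, h k x = a • f k x + b • g k x)
    (hh₀ : h₀ =ᵐ[ρ] fun x => a • f₀ x + b • g₀ x) :
    Tendsto (fun k => eLpNorm (fun x => h k x - h₀ x) 2 ρ) atTop (𝓝 0) := by
  have hub : Tendsto (fun k => ‖a‖ₑ * eLpNorm (fun x => f k x - f₀ x) 2 ρ +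
      ‖b‖ₑ * eLpNorm (fun x => g k x - g₀ x) 2 ρ) atTop (𝓝 0) := by
    simpa using (ENNReal.Tendsto.const_mul hfl (Or.inr (by simp))).add
      (ENNReal.Tendsto.const_mul hgl (Or.inr (by simp)))
  refine tendsto_of_tendsto_of_tendsto_of_le_of_le tendsto_const_nhds hub (fun _ => zero_le) ?_
  intro k
  have key : (fun x => h k x - h₀ x) =ᵐ[ρ]
      (a • fun x => f k x - f₀ x) + (b • fun x => g k x - g₀ x) := by
    filter_upwards [hh₀] with x hx
    simp only [hh, hx, Pi.add_apply, Pi.smul_apply, smul_sub]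
    abel
  show eLpNorm (fun x => h k x - h₀ x) 2 ρ ≤ _
  rw [eLpNorm_congr_ae key]
  refine (eLpNorm_add_le (((hf k).sub hf₀).const_smul a) (((hg k).sub hg₀).const_smul b)
    (by norm_num)).trans ?_
  rw [eLpNorm_const_smul, eLpNorm_const_smul]
  exact le_rfl

end LTwo

/-! ### Test fields -/

section Test

variable {d : ℕ} {Ω : Set (E d)}

lemma IsTestField.lincomb {F : Type*} [NormedAddCommGroup F] [NormedSpace ℝ F] {φ ψ : E d → F}
    (hφ : IsTestField Ω φ) (hψ : IsTestField Ω ψ) (a b : ℝ) :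
    IsTestField Ω (a • φ + b • ψ) where
  contDiff := (hφ.contDiff.const_smul a).add (hψ.contDiff.const_smul b)
  compact := (hφ.compact.smul_left (f := fun _ => a)).add (hψ.compact.smul_left (f := fun _ => b))
  support := by
    refine (tsupport_add _ _).trans (Set.union_subset ?_ ?_)
    · exact (tsupport_smul_subset_right (fun _ => a) φ).trans hφ.support
    · exact (tsupport_smul_subset_right (fun _ => b) ψ).trans hψ.support

lemma IsTestField.mul_left {φ ψ : E d → ℝ} (hφ : IsTestField Ω φ) (hψ : ContDiff ℝ ∞ ψ) :
    IsTestField Ω (fun x => ψ x * φ x) where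
  contDiff := hψ.mul hφ.contDiff
  compact := hφ.compact.mul_left
  support := (tsupport_mul_subset_right (f := ψ) (g := φ)).trans hφ.support

lemma IsTestField.component {m : ℕ} {φ : E d → Fin m → ℝ} (hφ : IsTestField Ω φ) (i : Fin m) :
    IsTestField Ω (fun x => φ x i) where
  contDiff := contDiff_pi.1 hφ.contDiff i
  compact := hφ.compact.comp_left (g := fun y : Fin m → ℝ => y i) rfl
  support := (closure_mono (fun x hx => by
    simp only [Function.mem_support] at hx ⊢
    exact fun h => hx (by rw [h]; rfl))).trans hφ.support

lemma contDiff_partialDeriv {φ : E d → ℝ} (hφ : ContDiff ℝ ∞ φ) (j : Fin d) :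
    ContDiff ℝ ∞ (partialDeriv j φ) := by
  have : ContDiff ℝ ∞ (fderiv ℝ φ) := hφ.fderiv_right (m := ∞) (by simp)
  exact this.clm_apply contDiff_const

lemma IsTestField.partialDeriv {φ : E d → ℝ} (hφ : IsTestField Ω φ) (j : Fin d) :
    IsTestField Ω (partialDeriv j φ) where
  contDiff := contDiff_partialDeriv hφ.contDiff j
  compact := hφ.compact.fderiv_apply ℝ _
  support := by
    refine (closure_minimal ?_ (isClosed_tsupport φ)).trans hφ.support
    intro x hx
    by_contra h
    refine hx ?_
    have : fderiv ℝ φ x = 0 :=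
      Function.notMem_support.1 (fun h' => h (support_fderiv_subset ℝ h'))
    simp [MHD.partialDeriv, this]

lemma IsTestField.memLp {F : Type*} [NormedAddCommGroup F] [NormedSpace ℝ F] {φ : E d → F}
    (hφ : IsTestField Ω φ) (p : ENNReal) : MemLp φ p (volume.restrict Ω) :=
  (hφ.contDiff.continuous.memLp_of_hasCompactSupport hφ.compact).restrict Ω

lemma partialDeriv_lincomb {φ ψ : E d → ℝ} (hφ : ContDiff ℝ ∞ φ) (hψ : ContDiff ℝ ∞ ψ)
    (a b : ℝ) (j : Fin d) (x : E d) :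
    partialDeriv j (a • φ + b • ψ) x = a * partialDeriv j φ x + b * partialDeriv j ψ x := by
  have h1 : DifferentiableAt ℝ φ x := hφ.differentiable (by simp) x
  have h2 : DifferentiableAt ℝ ψ x := hψ.differentiable (by simp) x
  simp [partialDeriv, fderiv_add (h1.const_smul a) (h2.const_smul b), fderiv_const_smul h1,
    fderiv_const_smul h2]

lemma partialDeriv_mul {φ ψ : E d → ℝ} (hφ : ContDiff ℝ ∞ φ) (hψ : ContDiff ℝ ∞ ψ)
    (j : Fin d) (x : E d) :
    partialDeriv j (fun y => ψ y * φ y) x = ψ x * partialDeriv j φ x + φ x * partialDeriv j ψ x := by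
  have h1 : DifferentiableAt ℝ φ x := hφ.differentiable (by simp) x
  have h2 : DifferentiableAt ℝ ψ x := hψ.differentiable (by simp) x
  simp [partialDeriv, fderiv_fun_mul h2 h1]

end Test

/-! ### Weak derivatives -/

section Weak

variable {d : ℕ} {Ω : Set (E d)} {v w : E d → ℝ} {j : Fin d}

/-- The fundamental lemma of the calculus of variations, applied to the difference. It is what makes
the chosen representative `weakPartial` usable. -/
lemma IsWeakPartial.ae_unique (hΩ : IsOpen Ω) {g₁ g₂ : E d → ℝ} (h₁ : IsWeakPartial Ω j v g₁)
    (h₂ : IsWeakPartial Ω j v g₂) : g₁ =ᵐ[volume.restrict Ω] g₂ := by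
  have hg : MemLp (fun x => g₁ x - g₂ x) 2 (volume.restrict Ω) := h₁.memLp.sub h₂.memLp
  have hloc : LocallyIntegrableOn (fun x => g₁ x - g₂ x) Ω volume :=
    locallyIntegrableOn_of_locallyIntegrable_restrict (hg.locallyIntegrable (by norm_num))
  have := hΩ.ae_eq_zero_of_integral_contDiff_smul_eq_zero hloc (fun φ h1 h2 h3 => ?_)
  · rw [Filter.EventuallyEq, ae_restrict_iff' hΩ.measurableSet]
    filter_upwards [this] with x hx hxΩ
    exact sub_eq_zero.1 (hx hxΩ)
  · have hφ : IsTestField Ω φ := ⟨h1, h2, h3⟩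
    have hsupp : ∫ x, φ x • (g₁ x - g₂ x) = ∫ x in Ω, φ x • (g₁ x - g₂ x) := by
      refine (setIntegral_eq_integral_of_forall_compl_eq_zero fun x hx => ?_).symm
      rw [image_eq_zero_of_notMem_tsupport (fun h => hx (h3 h)), zero_smul]
    have e1 := h₁.integral_eq φ hφ
    have e2 := h₂.integral_eq φ hφ
    have i1 := integrable_mul_of_memLp_two h₁.memLp (hφ.memLp 2)
    have i2 := integrable_mul_of_memLp_two h₂.memLp (hφ.memLp 2)
    rw [hsupp]
    calc ∫ x in Ω, φ x • (g₁ x - g₂ x) = ∫ x in Ω, (g₁ x * φ x - g₂ x * φ x) := by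
          congr 1; ext x; simp only [smul_eq_mul]; ring
      _ = 0 := by rw [integral_sub i1 i2]; linarith

lemma IsWeakPartial.congr {g v' g' : E d → ℝ} (h : IsWeakPartial Ω j v g)
    (hv : v =ᵐ[volume.restrict Ω] v') (hg : g =ᵐ[volume.restrict Ω] g') :
    IsWeakPartial Ω j v' g' where
  memLp := h.memLp.ae_eq hg
  integral_eq φ hφ := by
    have e1 : ∫ x in Ω, v x * partialDeriv j φ x = ∫ x in Ω, v' x * partialDeriv j φ x :=
      integral_congr_ae (hv.mul (ae_eq_refl (partialDeriv j φ)))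
    have e2 : ∫ x in Ω, g x * φ x = ∫ x in Ω, g' x * φ x :=
      integral_congr_ae (hg.mul (ae_eq_refl φ))
    rw [← e1, ← e2, h.integral_eq φ hφ]

lemma IsWeakPartial.lincomb {g k : E d → ℝ} (hg : IsWeakPartial Ω j v g)
    (hk : IsWeakPartial Ω j w k) (hv : MemLp v 2 (volume.restrict Ω))
    (hw : MemLp w 2 (volume.restrict Ω)) (a b : ℝ) :
    IsWeakPartial Ω j (a • v + b • w) (a • g + b • k) where
  memLp := (hg.memLp.const_smul a).add (hk.memLp.const_smul b)
  integral_eq φ hφ := by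
    have comb : ∀ {p q ψ : E d → ℝ}, MemLp p 2 (volume.restrict Ω) →
        MemLp q 2 (volume.restrict Ω) → MemLp ψ 2 (volume.restrict Ω) →
        ∫ x in Ω, (a • p + b • q) x * ψ x =
          a * (∫ x in Ω, p x * ψ x) + b * ∫ x in Ω, q x * ψ x := by
      intro p q ψ hp hq hψ
      rw [← integral_const_mul, ← integral_const_mul, ← integral_add
        ((integrable_mul_of_memLp_two hp hψ).const_mul a)
        ((integrable_mul_of_memLp_two hq hψ).const_mul b)]
      congr 1; ext x; simp only [Pi.add_apply, Pi.smul_apply, smul_eq_mul]; ring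
    rw [comb hv hw ((hφ.partialDeriv j).memLp 2), comb hg.memLp hk.memLp (hφ.memLp 2),
      hg.integral_eq φ hφ, hk.integral_eq φ hφ]
    ring

lemma MemH1.isWeakPartial (hv : MemH1 Ω v) (j : Fin d) :
    IsWeakPartial Ω j v (weakPartial Ω j v) := by
  rw [weakPartial, dif_pos (hv.exists_partial j)]
  exact (hv.exists_partial j).choose_spec

lemma MemH1.memLp_weakPartial (hv : MemH1 Ω v) (j : Fin d) :
    MemLp (weakPartial Ω j v) 2 (volume.restrict Ω) := (hv.isWeakPartial j).memLp

lemma MemH1.lincomb (hv : MemH1 Ω v) (hw : MemH1 Ω w) (a b : ℝ) : MemH1 Ω (a • v + b • w) where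
  memLp := (hv.memLp.const_smul a).add (hw.memLp.const_smul b)
  exists_partial j := ⟨_, (hv.isWeakPartial j).lincomb (hw.isWeakPartial j) hv.memLp hw.memLp a b⟩

lemma MemH1.weakPartial_lincomb (hΩ : IsOpen Ω) (hv : MemH1 Ω v) (hw : MemH1 Ω w) (a b : ℝ)
    (j : Fin d) : weakPartial Ω j (a • v + b • w) =ᵐ[volume.restrict Ω]
      a • weakPartial Ω j v + b • weakPartial Ω j w :=
  ((hv.lincomb hw a b).isWeakPartial j).ae_unique hΩ
    ((hv.isWeakPartial j).lincomb (hw.isWeakPartial j) hv.memLp hw.memLp a b)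

lemma MemH1.congr (hv : MemH1 Ω v) (h : v =ᵐ[volume.restrict Ω] w) : MemH1 Ω w where
  memLp := hv.memLp.ae_eq h
  exists_partial j := ⟨_, (hv.isWeakPartial j).congr h (ae_eq_refl _)⟩

lemma MemH1.weakPartial_congr (hΩ : IsOpen Ω) (hv : MemH1 Ω v) (h : v =ᵐ[volume.restrict Ω] w)
    (j : Fin d) : weakPartial Ω j v =ᵐ[volume.restrict Ω] weakPartial Ω j w :=
  ((hv.isWeakPartial j).congr h (ae_eq_refl _)).ae_unique hΩ ((hv.congr h).isWeakPartial j)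

lemma MemH10.lincomb (hΩ : IsOpen Ω) (hv : MemH10 Ω v) (hw : MemH10 Ω w) (a b : ℝ) :
    MemH10 Ω (a • v + b • w) where
  memH1 := hv.memH1.lincomb hw.memH1 a b
  approx := by
    obtain ⟨φ, hφ, hφl, hφd⟩ := hv.approx
    obtain ⟨ψ, hψ, hψl, hψd⟩ := hw.approx
    refine ⟨fun k => a • φ k + b • ψ k, fun k => (hφ k).lincomb (hψ k) a b, ?_, fun j => ?_⟩
    · exact tendsto_eLpNorm_lincomb a b (fun k => ((hφ k).memLp 2).1) hv.memH1.memLp.1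
        (fun k => ((hψ k).memLp 2).1) hw.memH1.memLp.1 hφl hψl (fun _ _ => rfl) (ae_eq_refl _)
    · exact tendsto_eLpNorm_lincomb a b (fun k => (((hφ k).partialDeriv j).memLp 2).1)
        (hv.memH1.memLp_weakPartial j).1 (fun k => (((hψ k).partialDeriv j).memLp 2).1)
        (hw.memH1.memLp_weakPartial j).1 (hφd j) (hψd j)
        (fun k x => partialDeriv_lincomb (hφ k).contDiff (hψ k).contDiff a b j x)
        (hv.memH1.weakPartial_lincomb hΩ hw.memH1 a b j)

lemma MemH10.congr (hΩ : IsOpen Ω) (hv : MemH10 Ω v) (h : v =ᵐ[volume.restrict Ω] w) :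
    MemH10 Ω w where
  memH1 := hv.memH1.congr h
  approx := by
    obtain ⟨φ, hφ, hφl, hφd⟩ := hv.approx
    refine ⟨φ, hφ, hφl.congr fun k => ?_, fun j => (hφd j).congr fun k => ?_⟩
    · exact eLpNorm_congr_ae ((ae_eq_refl (φ k)).sub h)
    · exact eLpNorm_congr_ae
        ((ae_eq_refl (partialDeriv j (φ k))).sub (hv.memH1.weakPartial_congr hΩ h j))

/-! ### Integration by parts in `H¹₀(Ω)` -/

lemma memLp_top_of_isBounded (hΩ : IsOpen Ω) (hb : Bornology.IsBounded Ω) {ψ : E d → ℝ}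
    (hψ : Continuous ψ) : MemLp ψ ⊤ (volume.restrict Ω) := by
  obtain ⟨C, hC⟩ := hb.isCompact_closure.exists_bound_of_continuousOn hψ.continuousOn
  exact memLp_top_of_bound hψ.aestronglyMeasurable C
    ((ae_restrict_iff' hΩ.measurableSet).2 (Eventually.of_forall fun x hx =>
      hC x (subset_closure hx)))

/-- This is ∫ ∂_j(v²ψ) = 0. Approximating only one factor v by test functions suffices, and ψ needs
no compact support. Both the Poincaré inequality and skew-symmetry rest on it. -/
lemma MemH10.integral_sq_mul_partialDeriv (hΩ : IsOpen Ω) (hb : Bornology.IsBounded Ω)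
    (hv : MemH10 Ω v) {ψ : E d → ℝ} (hψ : ContDiff ℝ ∞ ψ) (j : Fin d) :
    ∫ x in Ω, (v x * v x) * partialDeriv j ψ x =
      -2 * ∫ x in Ω, (v x * weakPartial Ω j v x) * ψ x := by
  obtain ⟨φ, hφ, hφl, hφd⟩ := hv.approx
  have hvL := hv.memH1.memLp
  have hdL := hv.memH1.memLp_weakPartial j
  have hψb := memLp_top_of_isBounded hΩ hb hψ.continuous
  have hψ'b := memLp_top_of_isBounded hΩ hb (contDiff_partialDeriv hψ j).continuous
  have h1 : MemLp (fun x => v x * ψ x) 2 (volume.restrict Ω) := hψb.mul hvL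
  have h2 : MemLp (fun x => v x * partialDeriv j ψ x) 2 (volume.restrict Ω) := hψ'b.mul hvL
  have h3 : MemLp (fun x => weakPartial Ω j v x * ψ x) 2 (volume.restrict Ω) := hψb.mul hdL
  -- The definition of the weak derivative of v, with test function ψ φ_k and the product rule. Each
  -- of the three integrals passes to the limit φ_k → v.
  have hk : ∀ k, (∫ x in Ω, v x * ψ x * partialDeriv j (φ k) x) +
      (∫ x in Ω, v x * partialDeriv j ψ x * φ k x) =
      - ∫ x in Ω, weakPartial Ω j v x * ψ x * φ k x := by
    intro k
    have := (hv.memH1.isWeakPartial j).integral_eq _ ((hφ k).mul_left hψ)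
    rw [← integral_add (integrable_mul_of_memLp_two h1 (((hφ k).partialDeriv j).memLp 2))
      (integrable_mul_of_memLp_two h2 ((hφ k).memLp 2))]
    simp only [partialDeriv_mul (hφ k).contDiff hψ] at this
    convert this using 2
    · ext x; ring
    · congr 1; ext x; ring
  have l1 := tendsto_integral_mul_of_eLpNorm (fun k => ((hφ k).partialDeriv j).memLp 2) hdL h1
    (hφd j)
  have l2 := tendsto_integral_mul_of_eLpNorm (fun k => (hφ k).memLp 2) hvL h2 hφl
  have l3 := tendsto_integral_mul_of_eLpNorm (fun k => (hφ k).memLp 2) hvL h3 hφl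
  have key := tendsto_nhds_unique ((l1.add l2).congr hk) l3.neg
  have e1 : ∫ x in Ω, v x * ψ x * weakPartial Ω j v x =
    ∫ x in Ω, (v x * weakPartial Ω j v x) * ψ x := by congr 1; ext x; ring
  have e2 : ∫ x in Ω, v x * partialDeriv j ψ x * v x =
    ∫ x in Ω, (v x * v x) * partialDeriv j ψ x := by congr 1; ext x; ring
  have e3 : ∫ x in Ω, weakPartial Ω j v x * ψ x * v x =
    ∫ x in Ω, (v x * weakPartial Ω j v x) * ψ x := by congr 1; ext x; ring
  rw [e1, e2, e3] at key
  linarith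

/-- The preceding identity with ψ replaced by test functions tending to u in H¹. Boundedness of v
puts v² and v ∂_j v in L², so that both sides converge. -/
lemma MemH10.integral_sq_mul_weakPartial (hΩ : IsOpen Ω) (hb : Bornology.IsBounded Ω)
    {u : E d → ℝ} (hu : MemH10 Ω u) (hv : MemH10 Ω v) (hvb : MemLp v ⊤ (volume.restrict Ω))
    (j : Fin d) :
    ∫ x in Ω, (v x * v x) * weakPartial Ω j u x =
      -2 * ∫ x in Ω, (v x * weakPartial Ω j v x) * u x := by
  obtain ⟨φ, hφ, hφl, hφd⟩ := hu.approx
  have h1 : MemLp (fun x => v x * v x) 2 (volume.restrict Ω) := hvb.mul hv.memH1.memLp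
  have h2 : MemLp (fun x => v x * weakPartial Ω j v x) 2 (volume.restrict Ω) :=
    (hv.memH1.memLp_weakPartial j).mul hvb
  have l1 := tendsto_integral_mul_of_eLpNorm (fun k => ((hφ k).partialDeriv j).memLp 2)
    (hu.memH1.memLp_weakPartial j) h1 (hφd j)
  have l2 := tendsto_integral_mul_of_eLpNorm (fun k => (hφ k).memLp 2) hu.memH1.memLp h2 hφl
  exact tendsto_nhds_unique l1 ((l2.const_mul (-2)).congr fun k =>
    (hv.integral_sq_mul_partialDeriv hΩ hb (hφ k).contDiff j).symm)

/-- The Poincaré inequality in a bounded domain. -/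
lemma MemH10.poincare (hΩ : IsOpen Ω) (hv : MemH10 Ω v) {R : ℝ}
    (hR : ∀ x ∈ Ω, ‖x‖ ≤ R) (j : Fin d) :
    ∫ x in Ω, v x * v x ≤ 4 * R ^ 2 * ∫ x in Ω, weakPartial Ω j v x * weakPartial Ω j v x := by
  have hb : Bornology.IsBounded Ω := isBounded_iff_forall_norm_le.2 ⟨R, hR⟩
  -- Taking ψ = x_j gives ∫ v² = -2 ∫ x_j v ∂_j v, which Young's inequality closes.
  have hψ : ContDiff ℝ ∞ (fun x : E d => x j) := (EuclideanSpace.proj j : E d →L[ℝ] ℝ).contDiff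
  have hd : ∀ x, partialDeriv j (fun x : E d => x j) x = 1 := by
    intro x
    have : fderiv ℝ (fun x : E d => x j) x = (EuclideanSpace.proj j : E d →L[ℝ] ℝ) :=
      (EuclideanSpace.proj j : E d →L[ℝ] ℝ).fderiv
    simp [partialDeriv, this]
  have key := hv.integral_sq_mul_partialDeriv hΩ hb hψ j
  simp only [hd, mul_one] at key
  have hvL := hv.memH1.memLp
  have hdL := hv.memH1.memLp_weakPartial j
  have hle : -2 * ∫ x in Ω, (v x * weakPartial Ω j v x) * x j ≤
      1 / 2 * (∫ x in Ω, v x * v x) +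
        2 * R ^ 2 * ∫ x in Ω, weakPartial Ω j v x * weakPartial Ω j v x := by
    rw [← integral_const_mul, ← integral_const_mul, ← integral_const_mul,
      ← integral_add ((integrable_mul_of_memLp_two hvL hvL).const_mul _)
        ((integrable_mul_of_memLp_two hdL hdL).const_mul _)]
    have h3 : MemLp (fun x => weakPartial Ω j v x * x j) 2 (volume.restrict Ω) :=
      (memLp_top_of_isBounded hΩ hb hψ.continuous).mul hdL
    refine setIntegral_mono_on ?_ (((integrable_mul_of_memLp_two hvL hvL).const_mul _).add
        ((integrable_mul_of_memLp_two hdL hdL).const_mul _)) hΩ.measurableSet fun x hx => ?_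
    · refine ((integrable_mul_of_memLp_two hvL h3).const_mul (-2)).congr
        (Eventually.of_forall fun x => ?_)
      simp only; ring
    · have hxj : (x j) ^ 2 ≤ R ^ 2 :=
        sq_le_sq' (by have := PiLp.norm_apply_le x j; have := hR x hx
                      have := (abs_le.1 ((Real.norm_eq_abs _).symm.trans_le
                        (PiLp.norm_apply_le x j))).1
                      linarith)
          (((le_abs_self _).trans (PiLp.norm_apply_le x j)).trans (hR x hx))
      -- Half of this square is v²/2 + 2 x_j v ∂_j v + 2 x_j² (∂_j v)².
      nlinarith [sq_nonneg (v x + 2 * (x j) * weakPartial Ω j v x),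
        mul_le_mul_of_nonneg_right hxj (sq_nonneg (weakPartial Ω j v x))]
  linarith

end Weak

/-! ### The `L²` inner product of vector fields -/

section Inner

variable {d m : ℕ} {Ω : Set (E d)} {a b c : E d → Fin m → ℝ}

lemma integrable_dotProduct (ha : MemLp a 2 (volume.restrict Ω))
    (hb : MemLp b 2 (volume.restrict Ω)) :
    Integrable (fun x => a x ⬝ᵥ b x) (volume.restrict Ω) :=
  integrable_finsetSum _ fun i _ => integrable_mul_of_memLp_two (ha.eval i) (hb.eval i)

lemma l2inner_comm : l2inner Ω a b = l2inner Ω b a := by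
  simp only [l2inner, dotProduct_comm]

lemma l2inner_eq_sum (ha : MemLp a 2 (volume.restrict Ω)) (hb : MemLp b 2 (volume.restrict Ω)) :
    l2inner Ω a b = ∑ i, ∫ x in Ω, a x i * b x i :=
  integral_finsetSum _ fun i _ => integrable_mul_of_memLp_two (ha.eval i) (hb.eval i)

lemma l2inner_smul_left (t : ℝ) : l2inner Ω (t • a) b = t * l2inner Ω a b := by
  simp only [l2inner, Pi.smul_apply, smul_dotProduct, smul_eq_mul, integral_const_mul]

lemma l2inner_add_left (ha : MemLp a 2 (volume.restrict Ω)) (hb : MemLp b 2 (volume.restrict Ω))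
    (hc : MemLp c 2 (volume.restrict Ω)) :
    l2inner Ω (a + b) c = l2inner Ω a c + l2inner Ω b c := by
  simp only [l2inner, Pi.add_apply, add_dotProduct]
  exact integral_add (integrable_dotProduct ha hc) (integrable_dotProduct hb hc)

lemma l2inner_sub_left (ha : MemLp a 2 (volume.restrict Ω)) (hb : MemLp b 2 (volume.restrict Ω))
    (hc : MemLp c 2 (volume.restrict Ω)) :
    l2inner Ω (a - b) c = l2inner Ω a c - l2inner Ω b c := by
  simp only [l2inner, Pi.sub_apply, sub_dotProduct]
  exact integral_sub (integrable_dotProduct ha hc) (integrable_dotProduct hb hc)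

lemma l2inner_lincomb_left (s t : ℝ) (ha : MemLp a 2 (volume.restrict Ω))
    (hb : MemLp b 2 (volume.restrict Ω)) (hc : MemLp c 2 (volume.restrict Ω)) :
    l2inner Ω (s • a + t • b) c = s * l2inner Ω a c + t * l2inner Ω b c := by
  rw [l2inner_add_left (ha.const_smul s) (hb.const_smul t) hc, l2inner_smul_left,
    l2inner_smul_left]

lemma l2inner_lincomb_right (s t : ℝ) (ha : MemLp a 2 (volume.restrict Ω))
    (hb : MemLp b 2 (volume.restrict Ω)) (hc : MemLp c 2 (volume.restrict Ω)) :
    l2inner Ω c (s • a + t • b) = s * l2inner Ω c a + t * l2inner Ω c b := by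
  rw [l2inner_comm, l2inner_lincomb_left s t ha hb hc, l2inner_comm, l2inner_comm (a := b)]

lemma l2inner_congr {a' b' : E d → Fin m → ℝ} (ha : a =ᵐ[volume.restrict Ω] a')
    (hb : b =ᵐ[volume.restrict Ω] b') : l2inner Ω a b = l2inner Ω a' b' := by
  refine integral_congr_ae ?_
  filter_upwards [ha, hb] with x h1 h2
  rw [h1, h2]

lemma normSq_nonneg : 0 ≤ normSq Ω a :=
  integral_nonneg fun x => Finset.sum_nonneg fun i _ => mul_self_nonneg (a x i)

lemma ae_eq_zero_of_normSq_eq_zero (ha : MemLp a 2 (volume.restrict Ω)) (h : normSq Ω a = 0) :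
    a =ᵐ[volume.restrict Ω] 0 := by
  have := (integral_eq_zero_iff_of_nonneg
    (fun x => Finset.sum_nonneg fun i _ => mul_self_nonneg (a x i))
    (integrable_dotProduct ha ha)).1 h
  filter_upwards [this] with x hx
  exact dotProduct_self_eq_zero.1 hx

/-- Young's inequality. -/
lemma l2inner_le (ha : MemLp a 2 (volume.restrict Ω)) (hb : MemLp b 2 (volume.restrict Ω))
    {ε : ℝ} (hε : 0 < ε) :
    l2inner Ω a b ≤ 1 / (2 * ε) * normSq Ω a + ε / 2 * normSq Ω b := by
  -- Expand ‖a - εb‖² ≥ 0 and divide by 2ε.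
  have key : 0 ≤ normSq Ω (a + (-ε) • b) := normSq_nonneg
  have e : normSq Ω (a + (-ε) • b) =
      normSq Ω a - 2 * ε * l2inner Ω a b + ε ^ 2 * normSq Ω b := by
    have h := ha.add (hb.const_smul (-ε))
    rw [normSq, l2inner_add_left ha (hb.const_smul _) h, l2inner_smul_left,
      l2inner_comm (a := a), l2inner_comm (a := b), l2inner_add_left ha (hb.const_smul _) ha,
      l2inner_add_left ha (hb.const_smul _) hb, l2inner_smul_left, l2inner_smul_left,
      l2inner_comm (a := b) (b := a)]
    simp only [normSq]
    ring
  rw [e] at key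
  have : 1 / (2 * ε) * normSq Ω a + ε / 2 * normSq Ω b - l2inner Ω a b =
      1 / (2 * ε) * (normSq Ω a - 2 * ε * l2inner Ω a b + ε ^ 2 * normSq Ω b) := by
    field_simp
    ring
  have h2 : 0 ≤ 1 / (2 * ε) * (normSq Ω a - 2 * ε * l2inner Ω a b + ε ^ 2 * normSq Ω b) := by
    positivity
  linarith

/-- `Fin m → ℝ` carries the sup norm, so `eLpNorm` is not the norm behind `normSq`. Convergence is
therefore used component by component. -/
lemma tendsto_l2inner {f : ℕ → E d → Fin m → ℝ} (hf : ∀ k, MemLp (f k) 2 (volume.restrict Ω))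
    (ha : MemLp a 2 (volume.restrict Ω)) (hb : MemLp b 2 (volume.restrict Ω))
    (hlim : Tendsto (fun k => eLpNorm (fun x => f k x - a x) 2 (volume.restrict Ω)) atTop (𝓝 0)) :
    Tendsto (fun k => l2inner Ω b (f k)) atTop (𝓝 (l2inner Ω b a)) := by
  simp only [l2inner_eq_sum hb ha, fun k => l2inner_eq_sum hb (hf k)]
  refine tendsto_finsetSum _ fun i _ =>
    tendsto_integral_mul_of_eLpNorm (fun k => (hf k).eval i) (ha.eval i) (hb.eval i) ?_
  refine tendsto_of_tendsto_of_tendsto_of_le_of_le tendsto_const_nhds hlim (fun _ => zero_le)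
    fun k => eLpNorm_mono fun x => ?_
  exact norm_le_pi_norm (f k x - a x) i

end Inner

/-! ### Gradient, divergence and curl -/

section Curl

lemma curlOf_lincomb (d : ℕ) (a b : ℝ) (G G' : Matrix (Fin d) (Fin d) ℝ) :
    curlOf d (a • G + b • G') = a • curlOf d G + b • curlOf d G' := by
  match d with
  | 0 | 1 => simp [curlOf]
  | 2 => ext i; fin_cases i; simp [curlOf]; ring
  | 3 => ext i; fin_cases i <;> simp [curlOf] <;> ring
  | (n + 4) => simp [curlOf]

lemma memLp_curlOf {d : ℕ} {ρ : Measure (E d)} {G : E d → Matrix (Fin d) (Fin d) ℝ}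
    (h : ∀ i j, MemLp (fun x => G x i j) 2 ρ) : MemLp (fun x => curlOf d (G x)) 2 ρ := by
  match d with
  | 0 | 1 => exact MemLp.zero'
  | 2 =>
    refine memLp_pi_iff.2 fun i => ?_
    fin_cases i
    exact (h 1 0).sub (h 0 1)
  | 3 =>
    refine memLp_pi_iff.2 fun i => ?_
    fin_cases i
    · exact (h 2 1).sub (h 1 2)
    · exact (h 0 2).sub (h 2 0)
    · exact (h 1 0).sub (h 0 1)
  | (n + 4) => exact MemLp.zero'

/-- The scalar triple product identity `(h × c) · u = (u × h) · c`. -/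
lemma crossCurl_dotProduct {d : ℕ} (hd : d = 2 ∨ d = 3) (h u : Fin d → ℝ)
    (c : Fin (curlDim d) → ℝ) : crossCurl d h c ⬝ᵥ u = cross d u h ⬝ᵥ c := by
  rcases hd with rfl | rfl
  · have h1 : cross 2 u h ⬝ᵥ c = (u 0 * h 1 - u 1 * h 0) * c (0 : Fin 1) :=
      Fin.sum_univ_one fun i : Fin 1 => cross 2 u h i * c i
    rw [h1]
    simp only [crossCurl, dotProduct, Fin.sum_univ_two, Matrix.cons_val_zero, Matrix.cons_val_one]
    ring
  · simp only [crossCurl, cross]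
    rw [dotProduct_comm, dotProduct_comm _ c]
    exact triple_product_permutation u h c |>.trans (triple_product_permutation h c u)

variable {d : ℕ} {Ω : Set (E d)} {v w : E d → Fin d → ℝ}

lemma weakGrad_lincomb (hΩ : IsOpen Ω) (hv : ∀ i, MemH1 Ω (fun x => v x i))
    (hw : ∀ i, MemH1 Ω (fun x => w x i)) (a b : ℝ) :
    weakGrad Ω (a • v + b • w) =ᵐ[volume.restrict Ω]
      fun x => a • weakGrad Ω v x + b • weakGrad Ω w x := by
  have : ∀ᵐ x ∂volume.restrict Ω, ∀ i j, weakGrad Ω (a • v + b • w) x i j =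
      a * weakGrad Ω v x i j + b * weakGrad Ω w x i j :=
    ae_all_iff.2 fun i => ae_all_iff.2 fun j => (hv i).weakPartial_lincomb hΩ (hw i) a b j
  filter_upwards [this] with x hx
  ext i j
  exact hx i j

lemma weakGrad_congr (hΩ : IsOpen Ω) (hv : ∀ i, MemH1 Ω (fun x => v x i))
    (h : v =ᵐ[volume.restrict Ω] w) :
    weakGrad Ω v =ᵐ[volume.restrict Ω] weakGrad Ω w := by
  have : ∀ᵐ x ∂volume.restrict Ω, ∀ i j, weakGrad Ω v x i j = weakGrad Ω w x i j :=
    ae_all_iff.2 fun i => ae_all_iff.2 fun j => (hv i).weakPartial_congr hΩ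
      (h.mono fun x hx => congrFun hx i) j
  filter_upwards [this] with x hx
  ext i j
  exact hx i j

lemma memLp_weakGrad (hv : ∀ i, MemH1 Ω (fun x => v x i)) (i j : Fin d) :
    MemLp (fun x => weakGrad Ω v x i j) 2 (volume.restrict Ω) :=
  (hv i).memLp_weakPartial j

lemma memLp_div (hv : ∀ i, MemH1 Ω (fun x => v x i)) :
    MemLp (div Ω v) 2 (volume.restrict Ω) :=
  memLp_finsetSum Finset.univ fun i _ => memLp_weakGrad hv i i

lemma memLp_curl (hv : ∀ i, MemH1 Ω (fun x => v x i)) :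
    MemLp (curl Ω v) 2 (volume.restrict Ω) :=
  memLp_curlOf (memLp_weakGrad hv)

lemma IsTestField.memLp_classicalCurl {φ : E d → Fin d → ℝ} (hφ : IsTestField Ω φ) :
    MemLp (classicalCurl φ) 2 (volume.restrict Ω) :=
  memLp_curlOf fun i j => ((hφ.component i).partialDeriv j).memLp 2

lemma integral_mul_div_lincomb (hΩ : IsOpen Ω) (hv : ∀ i, MemH1 Ω (fun x => v x i))
    (hw : ∀ i, MemH1 Ω (fun x => w x i)) (a b : ℝ) {q : E d → ℝ}
    (hq : MemLp q 2 (volume.restrict Ω)) :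
    ∫ x in Ω, div Ω (a • v + b • w) x * q x =
      a * (∫ x in Ω, div Ω v x * q x) + b * ∫ x in Ω, div Ω w x * q x := by
  rw [← integral_const_mul, ← integral_const_mul, ← integral_add
    ((integrable_mul_of_memLp_two (memLp_div hv) hq).const_mul a)
    ((integrable_mul_of_memLp_two (memLp_div hw) hq).const_mul b)]
  refine integral_congr_ae ?_
  filter_upwards [weakGrad_lincomb hΩ hv hw a b] with x hx
  simp only [div, hx, Matrix.trace_add, Matrix.trace_smul, smul_eq_mul]
  ring

lemma MemRingH1.lincomb (hΩ : IsOpen Ω) (hv : MemRingH1 Ω v) (hw : MemRingH1 Ω w) (a b : ℝ) :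
    MemRingH1 Ω (a • v + b • w) where
  memH1 i := (hv.memH1 i).lincomb (hw.memH1 i) a b
  approx := by
    obtain ⟨φ, hφ, hφl, hφd⟩ := hv.approx
    obtain ⟨ψ, hψ, hψl, hψd⟩ := hw.approx
    have hvL : MemLp v 2 (volume.restrict Ω) := memLp_pi_iff.2 fun i => (hv.memH1 i).memLp
    have hwL : MemLp w 2 (volume.restrict Ω) := memLp_pi_iff.2 fun i => (hw.memH1 i).memLp
    refine ⟨fun k => a • φ k + b • ψ k, fun k => (hφ k).lincomb (hψ k) a b, ?_, ?_⟩
    · exact tendsto_eLpNorm_lincomb a b (fun k => ((hφ k).memLp 2).1) hvL.1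
        (fun k => ((hψ k).memLp 2).1) hwL.1 hφl hψl (fun _ _ => rfl) (ae_eq_refl _)
    · refine tendsto_eLpNorm_lincomb a b (fun k => (hφ k).memLp_classicalCurl.1)
        (memLp_curl hv.memH1).1 (fun k => (hψ k).memLp_classicalCurl.1)
        (memLp_curl hw.memH1).1 hφd hψd (fun k x => ?_) ?_
      · refine Eq.trans ?_ (curlOf_lincomb d a b _ _)
        refine congrArg (curlOf d) ?_
        ext i j
        exact partialDeriv_lincomb ((hφ k).component i).contDiff ((hψ k).component i).contDiff
          a b j x
      · filter_upwards [weakGrad_lincomb hΩ hv.memH1 hw.memH1 a b] with x hx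
        rw [curl, hx, curlOf_lincomb]
        rfl

lemma MemRingH1.memLp (hw : MemRingH1 Ω w) : MemLp w 2 (volume.restrict Ω) :=
  memLp_pi_iff.2 fun i => (hw.memH1 i).memLp

/-- Integration by parts: `(∇ × J, w) = (J, ∇ × w)` if `w × n = 0` on the boundary. -/
lemma MemHCurl.l2inner_sourceCurl {J : E d → Fin (curlDim d) → ℝ} (hJ : MemHCurl Ω J)
    (hw : MemRingH1 Ω w) : l2inner Ω (sourceCurl Ω J) w = l2inner Ω J (curl Ω w) := by
  have hg : IsSourceCurl Ω J (sourceCurl Ω J) := by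
    rw [sourceCurl, dif_pos hJ.exists_curl]
    exact hJ.exists_curl.choose_spec
  obtain ⟨φ, hφ, hφl, hφd⟩ := hw.approx
  -- For test fields the identity defines the weak curl; both sides are continuous along the
  -- approximation of w in H(curl).
  refine tendsto_nhds_unique (tendsto_l2inner (fun k => (hφ k).memLp 2) hw.memLp hg.memLp hφl) ?_
  exact (tendsto_l2inner (fun k => (hφ k).memLp_classicalCurl) (memLp_curl hw.memH1) hJ.memLp
    hφd).congr fun k => hg.integral_eq _ (hφ k)

end Curl

/-! ### Triangulations and piecewise polynomials -/

section Triangulation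

variable {d : ℕ} {Ω : Set (E d)} {K : Geometry.SimplicialComplex ℝ (E d)} {r : ℕ}

lemma IsConvexPolyhedralDomain.isOpen (h : IsConvexPolyhedralDomain Ω) : IsOpen Ω := by
  obtain ⟨-, V, rfl⟩ := h
  exact isOpen_interior

lemma IsConvexPolyhedralDomain.isBounded (h : IsConvexPolyhedralDomain Ω) :
    Bornology.IsBounded Ω := by
  obtain ⟨-, V, rfl⟩ := h
  exact (V.finite_toSet.isCompact_convexHull ℝ).isBounded.subset interior_subset

lemma isCompact_convexHull_finset (s : Finset (E d)) : IsCompact (convexHull ℝ (s : Set (E d))) :=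
  s.finite_toSet.isCompact_convexHull ℝ

/-- Affinely independent points span the whole space only if there are d + 1 of them; otherwise the
face lies in a proper affine subspace. -/
lemma volume_convexHull_face_eq_zero {s : Finset (E d)} (hs : s ∈ K.faces) (h : s.card ≠ d + 1) :
    volume (convexHull ℝ (s : Set (E d))) = 0 := by
  have hi := K.indep hs
  refine measure_mono_null (convexHull_subset_affineSpan (𝕜 := ℝ) _)
    (Measure.addHaar_affineSubspace volume (affineSpan ℝ (s : Set (E d))) fun htop => h ?_)
  have hr : Set.range ((↑) : s → E d) = (s : Set (E d)) := Subtype.range_coe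
  rw [← hr, hi.affineSpan_eq_top_iff_card_eq_finrank_add_one] at htop
  simpa using htop

lemma IsTriangulation.ae_exists_mem (hK : IsTriangulation Ω K) (hΩ : IsOpen Ω) :
    ∀ᵐ x ∂volume.restrict Ω, ∃ s : elements K, x ∈ convexHull ℝ ((s : Finset (E d)) : Set (E d)) := by
  have h0 : ∀ᵐ x ∂(volume : Measure (E d)), ∀ s ∈ K.faces, s.card ≠ d + 1 →
      x ∉ convexHull ℝ (s : Set (E d)) := by
    refine (ae_ball_iff hK.finite.countable).2 fun s hs => ?_
    by_cases h : s.card = d + 1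
    · exact Eventually.of_forall fun x hx => absurd h hx
    · filter_upwards [measure_eq_zero_iff_ae_notMem.1 (volume_convexHull_face_eq_zero hs h)]
        with x hx _
      exact hx
  rw [ae_restrict_iff' hΩ.measurableSet]
  filter_upwards [h0] with x hx hxΩ
  have : x ∈ K.space := hK.space_eq ▸ subset_closure hxΩ
  obtain ⟨s, hs, hxs⟩ := Geometry.SimplicialComplex.mem_space_iff.1 this
  exact ⟨⟨s, hs, by_contra fun h => hx s hs h hxs⟩, hxs⟩

lemma IsTriangulation.finite_elements (hK : IsTriangulation Ω K) : (elements K).Finite :=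
  hK.finite.subset fun _ h => h.1

lemma ae_forall_elements (hK : IsTriangulation Ω K) {p : Finset (E d) → E d → Prop}
    (h : ∀ s ∈ elements K, ∀ᵐ x ∂volume.restrict (convexHull ℝ (s : Set (E d))), p s x) :
    ∀ᵐ x ∂volume.restrict Ω, ∀ s ∈ elements K, x ∈ convexHull ℝ (s : Set (E d)) → p s x :=
  ae_restrict_of_ae ((ae_ball_iff hK.finite_elements.countable).2 fun s hs =>
    (ae_restrict_iff' (isCompact_convexHull_finset s).measurableSet).1 (h s hs))

lemma continuous_eval_mvPolynomial (P : MvPolynomial (Fin d) ℝ) :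
    Continuous fun x : E d => MvPolynomial.eval (fun i => x i) P :=
  P.continuous_eval.comp (continuous_pi fun i => (EuclideanSpace.proj i : E d →L[ℝ] ℝ).continuous)

/-- A polynomial is bounded on each compact simplex, and finitely many elements cover Ω up to a null
set. The bound may depend on the mesh, as it only guarantees integrability. -/
lemma IsPiecewisePoly.memLp_top (hΩ : IsOpen Ω) (hK : IsTriangulation Ω K) {v : E d → ℝ}
    (hv : IsPiecewisePoly K r v) (hm : AEStronglyMeasurable v (volume.restrict Ω)) :
    MemLp v ⊤ (volume.restrict Ω) := by
  have hb : ∀ s : Finset (E d), ∃ C : ℝ, s ∈ elements K →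
      ∀ᵐ x ∂volume.restrict (convexHull ℝ (s : Set (E d))), ‖v x‖ ≤ C := by
    intro s
    by_cases hs : s ∈ elements K
    · obtain ⟨P, -, hP⟩ := hv s hs
      obtain ⟨C, hC⟩ := (isCompact_convexHull_finset s).exists_bound_of_continuousOn
        (continuous_eval_mvPolynomial P).continuousOn
      refine ⟨C, fun _ => ?_⟩
      filter_upwards [hP, ae_restrict_mem (isCompact_convexHull_finset s).measurableSet]
        with x hx hxs
      rw [hx]
      exact hC x hxs
    · exact ⟨0, fun h => absurd h hs⟩
  choose C hC using hb
  refine memLp_top_of_bound hm (∑ s ∈ hK.finite_elements.toFinset, |C s|) ?_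
  filter_upwards [hK.ae_exists_mem hΩ, ae_forall_elements hK hC] with x hx hall
  obtain ⟨⟨s, hs⟩, hxs⟩ := hx
  refine (hall s hs hxs).trans ((le_abs_self _).trans ?_)
  exact Finset.single_le_sum (f := fun s => |C s|) (fun s _ => abs_nonneg _)
    (hK.finite_elements.mem_toFinset.2 hs)

lemma IsPiecewisePoly.lincomb {v w : E d → ℝ} (hv : IsPiecewisePoly K r v)
    (hw : IsPiecewisePoly K r w) (a b : ℝ) : IsPiecewisePoly K r (a • v + b • w) := by
  intro s hs
  obtain ⟨P, hP, hvP⟩ := hv s hs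
  obtain ⟨Q, hQ, hwQ⟩ := hw s hs
  refine ⟨a • P + b • Q, (MvPolynomial.totalDegree_add _ _).trans
    (max_le ((MvPolynomial.totalDegree_smul_le _ _).trans hP)
      ((MvPolynomial.totalDegree_smul_le _ _).trans hQ)), ?_⟩
  filter_upwards [hvP, hwQ] with x h1 h2
  simp [h1, h2, MvPolynomial.smul_eval]

variable {v w : E d → Fin d → ℝ}

lemma MemX.memH1 (hv : MemX Ω K r v) (i : Fin d) : MemH1 Ω (fun x => v x i) := (hv.memH10 i).memH1

lemma MemX.memLp (hv : MemX Ω K r v) : MemLp v 2 (volume.restrict Ω) :=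
  memLp_pi_iff.2 fun i => (hv.memH1 i).memLp

lemma MemX.lincomb (hΩ : IsOpen Ω) (hv : MemX Ω K r v) (hw : MemX Ω K r w) (a b : ℝ) :
    MemX Ω K r (a • v + b • w) where
  memH10 i := (hv.memH10 i).lincomb hΩ (hw.memH10 i) a b
  poly i := (hv.poly i).lincomb (hw.poly i) a b

lemma MemS.memLp (hv : MemS Ω K r v) : MemLp v 2 (volume.restrict Ω) := hv.memRingH1.memLp

lemma MemS.lincomb (hΩ : IsOpen Ω) (hv : MemS Ω K r v) (hw : MemS Ω K r w) (a b : ℝ) :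
    MemS Ω K r (a • v + b • w) where
  memRingH1 := hv.memRingH1.lincomb hΩ hw.memRingH1 a b
  poly i := (hv.poly i).lincomb (hw.poly i) a b

end Triangulation

/-! ### The discrete gradient -/

section DiscreteGrad

/-- The Riesz representation theorem for a positive semidefinite form in finite dimensions. -/
lemma exists_riesz_of_finiteDimensional {V : Type*} [AddCommGroup V] [Module ℝ V]
    [FiniteDimensional ℝ V] (B : V →ₗ[ℝ] V →ₗ[ℝ] ℝ) (hB : ∀ p q, B p q = B q p)
    (l : V →ₗ[ℝ] ℝ) (hl : ∀ p, B p p = 0 → l p = 0) : ∃ q, ∀ p, B p q = l p := by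
  -- In finite dimensions the range of B is the annihilator of its coannihilator. A vector p of the
  -- latter has B p p = 0, hence l p = 0.
  have hmem : l ∈ LinearMap.range B := by
    rw [← Subspace.dualCoannihilator_dualAnnihilator_eq (W := LinearMap.range B),
      Submodule.mem_dualAnnihilator]
    intro p hp
    exact hl p ((Submodule.mem_dualCoannihilator p).1 hp _ ⟨p, rfl⟩)
  obtain ⟨q, hq⟩ := hmem
  exact ⟨q, fun p => by rw [hB, hq]⟩

variable {d : ℕ} {Ω : Set (E d)} {K : Geometry.SimplicialComplex ℝ (E d)} {r : ℕ}

/-- The polynomials of degree at most `r`, chosen independently for each component on each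
element. -/
abbrev PolyData (K : Geometry.SimplicialComplex ℝ (E d)) (r : ℕ) :=
  elements K → Fin d → MvPolynomial.restrictTotalDegree (Fin d) ℝ r

open Classical in
/-- The piecewise polynomial field with the given polynomials; a point in several elements is
assigned to one of them. -/
def PolyData.toField (P : PolyData K r) (x : E d) (i : Fin d) : ℝ :=
  if h : ∃ s : elements K, x ∈ convexHull ℝ ((s : Finset (E d)) : Set (E d)) then
    MvPolynomial.eval (fun i => x i) (P h.choose i : MvPolynomial (Fin d) ℝ)
  else 0

/-- Linearity is exact, not merely almost everywhere, because the element assigned to x does not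
depend on the polynomials. -/
lemma PolyData.toField_lincomb (P Q : PolyData K r) (a b : ℝ) :
    (a • P + b • Q).toField = a • P.toField + b • Q.toField := by
  ext x i
  by_cases h : ∃ s : elements K, x ∈ convexHull ℝ ((s : Finset (E d)) : Set (E d))
  · simp only [PolyData.toField, dif_pos h, Pi.add_apply, Pi.smul_apply, Submodule.coe_add,
      Submodule.coe_smul, map_add, MvPolynomial.smul_eval, smul_eq_mul]
  · simp [PolyData.toField, dif_neg h]

/-- Almost every x satisfies the polynomial identity on all elements containing it at once, so the
arbitrary choice in `toField` is harmless. -/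
lemma MemX.exists_polyData (hΩ : IsOpen Ω) (hK : IsTriangulation Ω K) {v : E d → Fin d → ℝ}
    (hv : MemX Ω K r v) : ∃ P : PolyData K r, v =ᵐ[volume.restrict Ω] P.toField := by
  have : ∀ (s : elements K) (i : Fin d),
      ∃ P : MvPolynomial.restrictTotalDegree (Fin d) ℝ r,
        ∀ᵐ x ∂volume.restrict (convexHull ℝ ((s : Finset (E d)) : Set (E d))),
          v x i = MvPolynomial.eval (fun i => x i) (P : MvPolynomial (Fin d) ℝ) := by
    intro s i
    obtain ⟨P, hP, h⟩ := hv.poly i s s.2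
    exact ⟨⟨P, (MvPolynomial.mem_restrictTotalDegree _ _ _).2 hP⟩, h⟩
  choose P hP using this
  refine ⟨P, ?_⟩
  have hall := ae_forall_elements hK (p := fun s x => ∀ (hs : s ∈ elements K) (i : Fin d),
      v x i = MvPolynomial.eval (fun i => x i) (P ⟨s, hs⟩ i : MvPolynomial (Fin d) ℝ))
    fun s hs => (ae_all_iff.2 (hP ⟨s, hs⟩)).mono fun x hx _ => hx
  filter_upwards [hK.ae_exists_mem hΩ, hall] with x hx hxall
  ext i
  rw [PolyData.toField, dif_pos hx]
  exact hxall _ hx.choose.2 hx.choose_spec hx.choose.2 i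

/-- The derivative part needs an argument: `weakPartial` of zero is a chosen representative that
vanishes only almost everywhere. -/
lemma memX_zero (hΩ : IsOpen Ω) : MemX Ω K r 0 := by
  have hp : ∀ j, IsWeakPartial Ω j (0 : E d → ℝ) 0 := fun j => ⟨MemLp.zero, fun φ _ => by simp⟩
  have h1 : MemH1 Ω (0 : E d → ℝ) := ⟨MemLp.zero, fun j => ⟨0, hp j⟩⟩
  refine ⟨fun i => ⟨h1, fun _ => 0, fun k => ⟨contDiff_const, HasCompactSupport.zero, ?_⟩, ?_, ?_⟩,
    fun i s _ => ⟨0, by simp, by simp⟩⟩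
  · simp [tsupport]
  · simp
  · intro j
    have : (fun x => partialDeriv j (0 : E d → ℝ) x - weakPartial Ω j (fun _ => (0 : ℝ)) x)
        =ᵐ[volume.restrict Ω] 0 := by
      filter_upwards [(h1.isWeakPartial j).ae_unique hΩ (hp j)] with x hx
      have hx' : weakPartial Ω j (fun _ => (0 : ℝ)) x = 0 := hx
      simp [partialDeriv, hx']
    simp only [Pi.zero_apply]
    rw [eLpNorm_congr_ae this]
    simp

/-- The data of the fields in `X_h`. -/
def polyDataX (hΩ : IsOpen Ω) (K : Geometry.SimplicialComplex ℝ (E d)) (r : ℕ) :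
    Submodule ℝ (PolyData K r) where
  carrier := {P | ∃ v, MemX Ω K r v ∧ v =ᵐ[volume.restrict Ω] P.toField}
  zero_mem' := ⟨0, memX_zero hΩ, by
    have := PolyData.toField_lincomb (0 : PolyData K r) 0 0 0
    simp only [smul_zero, zero_smul, add_zero] at this
    rw [this]⟩
  add_mem' := by
    rintro P Q ⟨v, hv, hvP⟩ ⟨w, hw, hwQ⟩
    refine ⟨_, hv.lincomb hΩ hw 1 1, ?_⟩
    have := PolyData.toField_lincomb P Q 1 1
    simp only [one_smul] at this ⊢
    rw [this]
    exact hvP.add hwQ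
  smul_mem' := by
    rintro a P ⟨v, hv, hvP⟩
    refine ⟨_, hv.lincomb hΩ hv a 0, ?_⟩
    have := PolyData.toField_lincomb P P a 0
    simp only [zero_smul, add_zero] at this ⊢
    rw [this]
    exact hvP.const_smul a

lemma memH1_of_mem_polyDataX {hΩ : IsOpen Ω} {P : PolyData K r} (hP : P ∈ polyDataX hΩ K r)
    (i : Fin d) : MemH1 Ω (fun x => P.toField x i) := by
  obtain ⟨v, hv, h⟩ := hP
  exact (hv.memH1 i).congr (h.mono fun x hx => congrFun hx i)

lemma memLp_of_mem_polyDataX {hΩ : IsOpen Ω} {P : PolyData K r} (hP : P ∈ polyDataX hΩ K r) :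
    MemLp P.toField 2 (volume.restrict Ω) :=
  memLp_pi_iff.2 fun i => (memH1_of_mem_polyDataX hP i).memLp

lemma integral_div_congr (hΩ : IsOpen Ω) {v w : E d → Fin d → ℝ}
    (hv : ∀ i, MemH1 Ω (fun x => v x i)) (h : v =ᵐ[volume.restrict Ω] w) (q : E d → ℝ) :
    ∫ x in Ω, div Ω v x * q x = ∫ x in Ω, div Ω w x * q x := by
  refine integral_congr_ae ?_
  filter_upwards [weakGrad_congr hΩ hv h] with x hx
  simp only [div, hx]

lemma linear_of_lincomb {V : Type*} [AddCommMonoid V] [Module ℝ V] {f : V → ℝ}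
    (h : ∀ (a b : ℝ) p q, f (a • p + b • q) = a * f p + b * f q) : IsLinearMap ℝ f where
  map_add p q := by simpa using h 1 1 p q
  map_smul a p := by simpa using h a 0 p p

/-- `MemX` describes functions rather than classes, and leaves them free off Ω, so the Riesz
argument is run on the finite-dimensional coefficient space `polyDataX`. Definiteness of the L² form
there is not needed: data of zero norm have an almost everywhere zero field, on which the functional
vanishes. -/
theorem exists_isDiscreteGrad (hΩ : IsOpen Ω) (hK : IsTriangulation Ω K) {q : E d → ℝ}
    (hq : MemLp q 2 (volume.restrict Ω)) : ∃ g, IsDiscreteGrad Ω K r q g := by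
  have : Finite (elements K) := hK.finite_elements
  let S := polyDataX hΩ K r
  have hcoe : ∀ (a b : ℝ) (P Q : S), (((a • P + b • Q : S) : PolyData K r)).toField =
      a • (P : PolyData K r).toField + b • (Q : PolyData K r).toField :=
    fun a b P Q => PolyData.toField_lincomb _ _ a b
  let F : S → S → ℝ := fun P Q => l2inner Ω (P : PolyData K r).toField (Q : PolyData K r).toField
  have hF₁ : ∀ Q, IsLinearMap ℝ (fun P => F P Q) := fun Q => linear_of_lincomb fun a b P P' => by
    simp only [F, hcoe]
    exact l2inner_lincomb_left a b (memLp_of_mem_polyDataX P.2) (memLp_of_mem_polyDataX P'.2)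
      (memLp_of_mem_polyDataX Q.2)
  have hF₂ : ∀ P, IsLinearMap ℝ (F P) := fun P => linear_of_lincomb fun a b Q Q' => by
    simp only [F, hcoe]
    exact l2inner_lincomb_right a b (memLp_of_mem_polyDataX Q.2) (memLp_of_mem_polyDataX Q'.2)
      (memLp_of_mem_polyDataX P.2)
  let B : S →ₗ[ℝ] S →ₗ[ℝ] ℝ := LinearMap.mk₂ ℝ F (fun P P' Q => (hF₁ Q).map_add P P')
    (fun a P Q => (hF₁ Q).map_smul a P) (fun P Q Q' => (hF₂ P).map_add Q Q')
    (fun a P Q => (hF₂ P).map_smul a Q)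
  let l₀ : S → ℝ := fun P => - ∫ x in Ω, div Ω (P : PolyData K r).toField x * q x
  have hl₀ : IsLinearMap ℝ l₀ := linear_of_lincomb fun a b P Q => by
    simp only [l₀, hcoe]
    rw [integral_mul_div_lincomb hΩ (memH1_of_mem_polyDataX P.2) (memH1_of_mem_polyDataX Q.2) a b hq]
    ring
  obtain ⟨Q, hQ⟩ := exists_riesz_of_finiteDimensional B (fun _ _ => l2inner_comm) (hl₀.mk' l₀)
    fun P hP => by
      have h0 := ae_eq_zero_of_normSq_eq_zero (memLp_of_mem_polyDataX P.2) hP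
      have h1 := integral_div_congr hΩ (memH1_of_mem_polyDataX P.2) h0 q
      -- Combining zero with coefficients 0 and 0 shows that the divergence of the zero field
      -- integrates to zero against q.
      have h2 := integral_mul_div_lincomb hΩ (memX_zero (K := K) (r := r) hΩ).memH1
        (memX_zero (K := K) (r := r) hΩ).memH1 0 0 hq
      simp only [zero_smul, add_zero, zero_mul] at h2
      show - ∫ x in Ω, div Ω (P : PolyData K r).toField x * q x = 0
      rw [h1, h2, neg_zero]
  obtain ⟨g, hg, hgQ⟩ := Q.2
  refine ⟨g, hg, fun v hv => ?_⟩
  obtain ⟨P, hP⟩ := hv.exists_polyData hΩ hK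
  rw [l2inner_congr hP hgQ, integral_div_congr hΩ hv.memH1 hP]
  exact hQ ⟨P, v, hv, hP⟩

lemma isDiscreteGrad_discreteGrad (hΩ : IsOpen Ω) (hK : IsTriangulation Ω K) {q : E d → ℝ}
    (hq : MemLp q 2 (volume.restrict Ω)) :
    IsDiscreteGrad Ω K r q (discreteGrad Ω K r q) := by
  rw [discreteGrad, dif_pos (exists_isDiscreteGrad hΩ hK hq)]
  exact (exists_isDiscreteGrad hΩ hK hq).choose_spec

end DiscreteGrad

/-! ### The energy estimate -/

section Energy

variable {d : ℕ} {Ω : Set (E d)} {K : Geometry.SimplicialComplex ℝ (E d)} {r : ℕ}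

lemma gradInner_self_eq_sum {v : E d → Fin d → ℝ} (hv : ∀ i, MemH1 Ω (fun x => v x i)) :
    gradInner Ω v v = ∑ i, ∑ j, ∫ x in Ω, weakGrad Ω v x i j * weakGrad Ω v x i j := by
  have hint : ∀ i j, Integrable (fun x => weakGrad Ω v x i j * weakGrad Ω v x i j)
      (volume.restrict Ω) :=
    fun i j => integrable_mul_of_memLp_two (memLp_weakGrad hv i j) (memLp_weakGrad hv i j)
  rw [gradInner, integral_finsetSum _ fun i _ => integrable_finsetSum _ fun j _ => hint i j]
  exact Finset.sum_congr rfl fun i _ => integral_finsetSum _ fun j _ => hint i j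

lemma normSq_le_gradInner (hΩ : IsOpen Ω) {v : E d → Fin d → ℝ}
    (hv : ∀ i, MemH10 Ω (fun x => v x i)) {R : ℝ} (hR : ∀ x ∈ Ω, ‖x‖ ≤ R) (j : Fin d) :
    normSq Ω v ≤ 4 * R ^ 2 * gradInner Ω v v := by
  have hL : MemLp v 2 (volume.restrict Ω) := memLp_pi_iff.2 fun i => (hv i).memH1.memLp
  rw [normSq, l2inner_eq_sum hL hL, gradInner_self_eq_sum fun i => (hv i).memH1, Finset.mul_sum]
  refine Finset.sum_le_sum fun i _ => ((hv i).poincare hΩ hR j).trans ?_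
  refine mul_le_mul_of_nonneg_left ?_ (by positivity)
  exact Finset.single_le_sum
    (f := fun j => ∫ x in Ω, weakGrad Ω v x i j * weakGrad Ω v x i j)
    (fun j _ => integral_nonneg fun x => mul_self_nonneg _) (Finset.mem_univ j)

/-- The convection form is skew-symmetric. -/
lemma trilinear_self (hΩ : IsOpen Ω) (hb : Bornology.IsBounded Ω) {u v : E d → Fin d → ℝ}
    (hu : ∀ i, MemH10 Ω (fun x => u x i)) (hv : ∀ i, MemH10 Ω (fun x => v x i))
    (hvb : ∀ i, MemLp (fun x => v x i) ⊤ (volume.restrict Ω)) :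
    trilinear Ω u v v = 0 := by
  have h1 : ∀ i j, MemLp (fun x => v x i * weakPartial Ω j (fun y => v y i) x) 2
      (volume.restrict Ω) := fun i j => ((hv i).memH1.memLp_weakPartial j).mul (hvb i)
  have h2 : ∀ i, MemLp (fun x => v x i * v x i) 2 (volume.restrict Ω) :=
    fun i => (hv i).memH1.memLp.mul (hvb i)
  have e1 : l2inner Ω (fun x => weakGrad Ω v x *ᵥ u x) v =
      ∑ i, ∑ j, ∫ x in Ω, (v x i * weakPartial Ω j (fun y => v y i) x) * u x j := by
    have hint : ∀ i j, Integrable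
        (fun x => (v x i * weakPartial Ω j (fun y => v y i) x) * u x j) (volume.restrict Ω) :=
      fun i j => integrable_mul_of_memLp_two (h1 i j) (hu j).memH1.memLp
    rw [← Finset.sum_congr rfl fun i _ => integral_finsetSum Finset.univ fun j _ => hint i j,
      ← integral_finsetSum _ fun i _ => integrable_finsetSum _ fun j _ => hint i j]
    refine integral_congr_ae (Eventually.of_forall fun x => ?_)
    simp only [dotProduct, Matrix.mulVec, weakGrad, Finset.sum_mul]
    exact Finset.sum_congr rfl fun i _ => Finset.sum_congr rfl fun j _ => by ring
  have e2 : l2inner Ω (fun x => div Ω u x • v x) v =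
      ∑ i, ∑ j, ∫ x in Ω, (v x i * v x i) * weakPartial Ω j (fun y => u y j) x := by
    have hint : ∀ i j, Integrable
        (fun x => (v x i * v x i) * weakPartial Ω j (fun y => u y j) x) (volume.restrict Ω) :=
      fun i j => integrable_mul_of_memLp_two (h2 i) ((hu j).memH1.memLp_weakPartial j)
    rw [← Finset.sum_congr rfl fun i _ => integral_finsetSum Finset.univ fun j _ => hint i j,
      ← integral_finsetSum _ fun i _ => integrable_finsetSum _ fun j _ => hint i j]
    refine integral_congr_ae (Eventually.of_forall fun x => ?_)
    simp only [dotProduct, div, Matrix.trace, Matrix.diag, weakGrad, Pi.smul_apply, smul_eq_mul,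
      Finset.sum_mul]
    exact Finset.sum_congr rfl fun i _ => Finset.sum_congr rfl fun j _ => by ring
  rw [trilinear, e1, e2]
  -- Each divergence integral is -2 times the matching convection integral, and the factor 1/2 in
  -- the form makes them cancel. No constraint on div u is needed.
  simp only [fun i j => (hu j).integral_sq_mul_weakPartial hΩ hb (hv i) (hvb i) j,
    ← Finset.mul_sum]
  ring

lemma normSq_sub {m : ℕ} {a b : E d → Fin m → ℝ} (ha : MemLp a 2 (volume.restrict Ω))
    (hb : MemLp b 2 (volume.restrict Ω)) :
    normSq Ω (a - b) = normSq Ω a - 2 * l2inner Ω a b + normSq Ω b := by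
  rw [normSq, l2inner_sub_left ha hb (ha.sub hb), l2inner_comm, l2inner_sub_left ha hb ha,
    l2inner_comm (a := b) (b := a - b), l2inner_sub_left ha hb hb, l2inner_comm (a := b) (b := a)]
  simp only [normSq]
  ring

/-- Write 3a/4 + c/4 = (a + b)/2 + ((a - b) - (b - c))/4. Polarizing both products gives equality up
to the dropped term ‖a - 2b + c‖²/(8τ). -/
lemma le_l2inner_check {m : ℕ} {a b c : E d → Fin m → ℝ} (ha : MemLp a 2 (volume.restrict Ω))
    (hb : MemLp b 2 (volume.restrict Ω)) (hc : MemLp c 2 (volume.restrict Ω)) {τ : ℝ}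
    (hτ : 0 < τ) :
    1 / (2 * τ) * (normSq Ω a - normSq Ω b) +
        1 / (8 * τ) * (normSq Ω (a - b) - normSq Ω (b - c)) ≤
      l2inner Ω (τ⁻¹ • (a - b)) ((3 / 4 : ℝ) • a + (1 / 4 : ℝ) • c) := by
  have h0 : 0 ≤ normSq Ω ((a - b) - (b - c)) := normSq_nonneg
  rw [normSq_sub (ha.sub hb) (hb.sub hc), l2inner_sub_left ha hb (hb.sub hc),
    l2inner_comm (a := a), l2inner_comm (a := b), l2inner_sub_left hb hc ha,
    l2inner_sub_left hb hc hb, normSq_sub ha hb, normSq_sub hb hc, l2inner_comm (a := b) (b := a),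
    l2inner_comm (a := c) (b := a), l2inner_comm (a := c) (b := b)] at h0
  rw [l2inner_smul_left, l2inner_lincomb_right _ _ ha hc (ha.sub hb), l2inner_sub_left ha hb ha,
    l2inner_sub_left ha hb hc, normSq_sub ha hb, normSq_sub hb hc, l2inner_comm (a := b) (b := a)]
  have h1 : 0 ≤ τ⁻¹ := (inv_pos.2 hτ).le
  have h2 := mul_nonneg h1 h0
  simp only [one_div, mul_inv, normSq] at *
  linarith

/-- The projection says û = u₁ + (τ/2)(g₁ - g₀), tested only against the four fields needed. As u₁
is orthogonal to g₀ and g₁, Pythagoras gives ‖û‖² = ‖u₁‖² + (τ²/4)‖g₁ - g₀‖², and (û, g₀) = (τ/2)(g₁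
- g₀, g₀). The mixed terms (g₁, g₀) then cancel. -/
lemma velocity_pressure_identity {u₀ u₁ û g₀ g₁ : E d → Fin d → ℝ}
    (hu₀ : MemLp u₀ 2 (volume.restrict Ω)) (hu₁ : MemLp u₁ 2 (volume.restrict Ω))
    (hû : MemLp û 2 (volume.restrict Ω)) (hg₀ : MemLp g₀ 2 (volume.restrict Ω))
    {τ : ℝ} (hτ : 0 < τ)
    (hproj : ∀ l ∈ ({u₁, û, g₀, g₁} : Set (E d → Fin d → ℝ)),
      l2inner Ω (τ⁻¹ • (u₁ - û)) l = -(1 / 2) * (l2inner Ω l g₁ - l2inner Ω l g₀))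
    (hg₁ : MemLp g₁ 2 (volume.restrict Ω))
    (h₁₁ : l2inner Ω u₁ g₁ = 0) (h₁₀ : l2inner Ω u₁ g₀ = 0) (h₀₀ : l2inner Ω u₀ g₀ = 0) :
    l2inner Ω (τ⁻¹ • (û - u₀)) ((1 / 2 : ℝ) • û + (1 / 2 : ℝ) • u₀) +
        l2inner Ω ((1 / 2 : ℝ) • û + (1 / 2 : ℝ) • u₀) g₀ =
      1 / (2 * τ) * (normSq Ω u₁ - normSq Ω u₀) + τ / 8 * (normSq Ω g₁ - normSq Ω g₀) := by
  have p1 := hproj u₁ (by simp)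
  have p2 := hproj û (by simp)
  have p3 := hproj g₀ (by simp)
  have p4 := hproj g₁ (by simp)
  rw [l2inner_smul_left, l2inner_sub_left hu₁ hû (by assumption),
    inv_mul_eq_iff_eq_mul₀ hτ.ne'] at p1 p2 p3 p4
  rw [l2inner_smul_left, l2inner_lincomb_right _ _ hû hu₀ (hû.sub hu₀),
    l2inner_lincomb_left _ _ hû hu₀ hg₀, l2inner_sub_left hû hu₀ hû, l2inner_sub_left hû hu₀ hu₀,
    l2inner_comm (a := u₀) (b := û), h₀₀]
  rw [l2inner_comm (a := û) (b := u₁), h₁₁, h₁₀] at p1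
  rw [h₁₀, l2inner_comm (a := g₀) (b := g₁)] at p3
  rw [h₁₁] at p4
  have e1 : l2inner Ω û g₁ = τ / 2 * (normSq Ω g₁ - l2inner Ω g₁ g₀) := by
    rw [normSq]; linarith
  have e0 : l2inner Ω û g₀ = τ / 2 * (l2inner Ω g₁ g₀ - normSq Ω g₀) := by
    rw [normSq]; linarith
  have e : l2inner Ω û û = normSq Ω u₁ +
      τ ^ 2 / 4 * (normSq Ω g₁ - 2 * l2inner Ω g₁ g₀ + normSq Ω g₀) := by
    rw [e0, e1] at p2
    simp only [normSq] at p2 ⊢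
    linarith
  rw [e, e0]
  simp only [normSq]
  field_simp
  ring

/-- The energy estimate for one step of the scheme, with an explicit constant. -/
theorem IsNumericalSolution.energy_le (hd : d = 2 ∨ d = 3) (hΩ : IsOpen Ω)
    {R : ℝ} (hR0 : 0 < R) (hR : ∀ x ∈ Ω, ‖x‖ ≤ R) (hK : IsTriangulation Ω K)
    {ν σ μ τ : ℝ} (hν : 0 < ν) (hσ : 0 < σ) (hμ : 0 < μ) (hτ : 0 < τ) {N : ℕ}
    {J : ℝ → E d → Fin (curlDim d) → ℝ} {f : ℝ → E d → Fin d → ℝ}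
    {H u uhat : ℕ → E d → Fin d → ℝ} {p : ℕ → E d → ℝ}
    (h : IsNumericalSolution Ω K r ν σ μ τ N J f H u uhat p) {n : ℕ} (hn : 1 ≤ n) (hnN : n < N)
    (hJ : MemHCurl Ω (J (midTime τ n))) (hf : MemLp (f (midTime τ n)) 2 (volume.restrict Ω))
    (hdiv : IsDiscretelyDivFree Ω K r (u n)) :
    μ / (2 * τ) * (normSq Ω (H (n + 1)) - normSq Ω (H n))
        + μ / (8 * τ) * (normSq Ω (H (n + 1) - H n) - normSq Ω (H n - H (n - 1)))
        + 1 / (2 * τ) * (normSq Ω (u (n + 1)) - normSq Ω (u n))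
        + τ / 8 * (normSq Ω (discreteGrad Ω K r (p (n + 1)))
            - normSq Ω (discreteGrad Ω K r (p n)))
      ≤ σ⁻¹ / 2 * normSq Ω (J (midTime τ n)) + R ^ 2 / ν * normSq Ω (f (midTime τ n)) := by
  have hb : Bornology.IsBounded Ω := isBounded_iff_forall_norm_le.2 ⟨R, hR⟩
  have j₀ : Fin d := ⟨0, by omega⟩
  have hHp := h.H_mem (n + 1) hnN
  have hH := h.H_mem n hnN.le
  have hHm := h.H_mem (n - 1) (by omega)
  have hup := h.u_mem (n + 1) hnN
  have hu := h.u_mem n hnN.le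
  have hum := h.u_mem (n - 1) (by omega)
  have hû := h.uhat_mem (n + 1) (by omega) hnN
  have hpp := h.p_mem (n + 1) (by omega) hnN
  have hp := h.p_mem n hn hnN.le
  have hgp := isDiscreteGrad_discreteGrad (r := r) hΩ hK hpp.memLp
  have hg := isDiscreteGrad_discreteGrad (r := r) hΩ hK hp.memLp
  have hcheck : MemS Ω K r (check H n) := hHp.lincomb hΩ hHm _ _
  have havg : MemX Ω K r (average uhat u n) := hû.lincomb hΩ hu _ _
  have hext : MemX Ω K r (extrapolate u n) := by
    have := hu.lincomb hΩ hum (3 / 2) (-(1 / 2))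
    rwa [neg_smul, ← sub_eq_add_neg] at this
  have hmag := h.magnetic n hn hnN _ hcheck
  have hmom := h.momentum n hn hnN _ havg
  have hmag₁ := mul_le_mul_of_nonneg_left
    (le_l2inner_check hHp.memLp hH.memLp hHm.memLp hτ) hμ.le
  have hdivH : 0 ≤ σ⁻¹ * ∫ x in Ω, div Ω (check H n) x * div Ω (check H n) x :=
    mul_nonneg (inv_pos.2 hσ).le (integral_nonneg fun x => mul_self_nonneg _)
  have hcoupling : l2inner Ω (fun x => crossCurl d (extrapolate H n x) (curl Ω (check H n) x))
      (average uhat u n) = l2inner Ω (fun x => cross d (average uhat u n x) (extrapolate H n x))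
      (curl Ω (check H n)) :=
    integral_congr_ae (Eventually.of_forall fun x => crossCurl_dotProduct hd _ _ _)
  have htri : trilinear Ω (extrapolate u n) (average uhat u n) (average uhat u n) = 0 :=
    trilinear_self hΩ hb hext.memH10 havg.memH10
      fun i => (havg.poly i).memLp_top hΩ hK (havg.memH1 i).memLp.1
  have hpress : - ∫ x in Ω, p n x * div Ω (average uhat u n) x =
      l2inner Ω (average uhat u n) (discreteGrad Ω K r (p n)) := by
    rw [hg.inner_eq _ havg]
    simp only [mul_comm]
  have hvel := velocity_pressure_identity hu.memLp hup.memLp hû.memLp hg.memX.memLp hτ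
    (fun l hl => by
      have hl' : MemX Ω K r l := by
        rcases hl with rfl | rfl | rfl | rfl
        exacts [hup, hû, hg.memX, hgp.memX]
      have hproj := h.projection n hn hnN l hl'
      have hsub : ∫ x in Ω, (p (n + 1) x - p n x) * div Ω l x =
          (∫ x in Ω, div Ω l x * p (n + 1) x) - ∫ x in Ω, div Ω l x * p n x := by
        rw [← integral_sub (integrable_mul_of_memLp_two (memLp_div hl'.memH1) hpp.memLp)
          (integrable_mul_of_memLp_two (memLp_div hl'.memH1) hp.memLp)]
        exact integral_congr_ae (Eventually.of_forall fun x => by ring)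
      rw [hgp.inner_eq l hl', hg.inner_eq l hl']
      rw [hsub] at hproj
      linarith) hgp.memX.memLp
    (by rw [hgp.inner_eq _ hup, h.incompressible n hn hnN _ hpp, neg_zero])
    (by rw [hg.inner_eq _ hup, h.incompressible n hn hnN _ hp, neg_zero])
    (by rw [hg.inner_eq _ hu, hdiv _ hp, neg_zero])
  have hJle := mul_le_mul_of_nonneg_left (l2inner_le hJ.memLp
    (memLp_curl hcheck.memRingH1.memH1) one_pos) (inv_pos.2 hσ).le
  -- Chosen so that (ε/2) · 4R² = ν: after the Poincaré inequality the f term uses up exactly the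
  -- viscous dissipation.
  have hε : 0 < ν / (2 * R ^ 2) := by positivity
  have hfle := l2inner_le hf havg.memLp hε
  have hpoin := mul_le_mul_of_nonneg_left (normSq_le_gradInner hΩ havg.memH10 hR j₀)
    (half_pos hε).le
  have c1 : 1 / (2 * (ν / (2 * R ^ 2))) = R ^ 2 / ν := by field_simp
  have c2 : ν / (2 * R ^ 2) / 2 * (4 * R ^ 2 * gradInner Ω (average uhat u n) (average uhat u n)) =
      ν * gradInner Ω (average uhat u n) (average uhat u n) := by field_simp; ring
  rw [c1] at hfle
  rw [c2] at hpoin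
  rw [hJ.l2inner_sourceCurl hcheck.memRingH1] at hmag
  rw [hcoupling, htri] at hmom
  have c3 : ∀ x y : ℝ, μ * (1 / (2 * τ) * x + 1 / (8 * τ) * y) =
      μ / (2 * τ) * x + μ / (8 * τ) * y := fun x y => by ring
  rw [c3] at hmag₁
  change _ ≤ μ * l2inner Ω (τ⁻¹ • (H (n + 1) - H n)) (check H n) at hmag₁
  change l2inner Ω (τ⁻¹ • (uhat (n + 1) - u n)) (average uhat u n) +
    l2inner Ω (average uhat u n) (discreteGrad Ω K r (p n)) = _ at hvel
  -- Young's inequality costs only half of the curl dissipation; the rest is discarded.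
  have hc : σ⁻¹ * (1 / (2 * 1) * normSq Ω (J (midTime τ n)) +
      1 / 2 * normSq Ω (curl Ω (check H n))) ≤ σ⁻¹ / 2 * normSq Ω (J (midTime τ n)) +
      σ⁻¹ * l2inner Ω (curl Ω (check H n)) (curl Ω (check H n)) := by
    have : 0 ≤ σ⁻¹ * normSq Ω (curl Ω (check H n)) :=
      mul_nonneg (inv_pos.2 hσ).le normSq_nonneg
    rw [show l2inner Ω (curl Ω (check H n)) (curl Ω (check H n)) =
      normSq Ω (curl Ω (check H n)) from rfl]
    linarith
  -- The sum of `hmag` and `hmom`, in which the coupling terms have opposite signs; the divergence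
  -- dissipation is dropped by `hdivH`.
  linarith

end Energy

end MHD

end

theorem theorem2p2 (d : ℕ) (hd : d = 2 ∨ d = 3) (Ω : Set (MHD.E d))
    (hΩ : MHD.IsConvexPolyhedralDomain Ω)
    (ν σ μ : ℝ) (hν : 0 < ν) (hσ : 0 < σ) (hμ : 0 < μ) :
    ∃ C : ℝ, 0 < C ∧
      ∀ (K : Geometry.SimplicialComplex ℝ (MHD.E d)), MHD.IsTriangulation Ω K →
      ∀ (r : ℕ), 2 ≤ r →
      ∀ (T : ℝ), 0 < T → ∀ (N : ℕ), 0 < N → ∀ (τ : ℝ), τ = T / N →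
      ∀ (J : ℝ → MHD.E d → Fin (MHD.curlDim d) → ℝ) (f : ℝ → MHD.E d → Fin d → ℝ),
      (∀ n : ℕ, 1 ≤ n → n < N → MHD.MemHCurl Ω (J (MHD.midTime τ n))) →
      (∀ n : ℕ, 1 ≤ n → n < N →
        MeasureTheory.MemLp (f (MHD.midTime τ n)) 2 (MeasureTheory.volume.restrict Ω)) →
      ∀ (H u uhat : ℕ → MHD.E d → Fin d → ℝ) (p : ℕ → MHD.E d → ℝ),
      MHD.IsNumericalSolution Ω K r ν σ μ τ N J f H u uhat p →
      ∀ n : ℕ, 1 ≤ n → n < N →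
      -- the starting velocity has to be discretely divergence-free for the first step
      (n = 1 → MHD.IsDiscretelyDivFree Ω K r (u 1)) →
        μ / (2 * τ) * (MHD.normSq Ω (H (n + 1)) - MHD.normSq Ω (H n))
          + μ / (8 * τ) * (MHD.normSq Ω (H (n + 1) - H n) - MHD.normSq Ω (H n - H (n - 1)))
          + 1 / (2 * τ) * (MHD.normSq Ω (u (n + 1)) - MHD.normSq Ω (u n))
          + τ / 8 * (MHD.normSq Ω (MHD.discreteGrad Ω K r (p (n + 1)))
              - MHD.normSq Ω (MHD.discreteGrad Ω K r (p n)))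
        ≤ C * (MHD.normSq Ω (J (MHD.midTime τ n)) + MHD.normSq Ω (f (MHD.midTime τ n))) := by
  have hopen := hΩ.isOpen
  obtain ⟨R, hR0, hR⟩ := hΩ.isBounded.exists_pos_norm_le
  -- The sum of the two source coefficients in `energy_le`; R depends on Ω alone.
  refine ⟨σ⁻¹ / 2 + R ^ 2 / ν, by positivity, ?_⟩
  intro K hK r _ T hT N hN τ hτ J f hJ hf H u uhat p h n hn hnN hdiv₁
  have hτ0 : 0 < τ := hτ ▸ div_pos hT (Nat.cast_pos.2 hN)
  have hdiv : MHD.IsDiscretelyDivFree Ω K r (u n) := by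
    -- Level 1 is a starting value, not produced by the scheme. For n ≥ 2 the constraint comes from
    -- step n - 1.
    rcases hn.eq_or_lt with h1 | h1
    · exact h1 ▸ hdiv₁ h1.symm
    · have := h.incompressible (n - 1) (by omega) (by omega)
      rwa [Nat.sub_add_cancel hn] at this
  refine (h.energy_le hd hopen hR0 hR hK hν hσ hμ hτ0 hn hnN (hJ n hn hnN) (hf n hn hnN)
    hdiv).trans ?_
  have a1 : 0 ≤ σ⁻¹ / 2 * MHD.normSq Ω (f (MHD.midTime τ n)) :=
    mul_nonneg (by positivity) MHD.normSq_nonneg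
  have a2 : 0 ≤ R ^ 2 / ν * MHD.normSq Ω (J (MHD.midTime τ n)) :=
    mul_nonneg (by positivity) MHD.normSq_nonneg
  linarith
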